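/- \textbf{Generalized D\'iaz--Saa inequality.} Let $N\ge 1$, $1<p<\infty$, $0<s<1$, $0<r\le p-1$, $\kappa\in(0,1]$, $\Lambda>0$. Let $\Omega\subset\mathbb{R}^N$ be open (for instance a bounded smooth domain), and let $W^{1,p}_0(\Omega)$ denote the space of $u\in W^{1,p}(\mathbb{R}^N)$ with $u=0$ a.e. in $\mathbb{R}^N\setminus\Omega$ (for a bounded domain with smooth boundary this is the usual space, functions being extended by zero). Let $\omega\subseteq\mathbb{R}^N$ be measurable. Let $K:\omega\times\omega\to[0,\infty)$ be measurable with $K(x,y)=K(y,x)$ and $$\frac{\kappa}{\Lambda|x-y|^{N+sp}}\le K(x,y)\le\frac{\kappa\Lambda}{|x-y|^{N+sp}}\qquad\text{for a.e. }x,y\in\omega .$$ Let $\mathcal H:\Omega\times\mathbb{R}^N\to[0,\infty)$ be a Carath\'eodory function such that for a.e. $x\in\Omega$ the map $z\mapsto\mathcal H(x,z)$ is $C^1$ and convex, and $\mathcal H(x,tz)=|t|^p\mathcal H(x,z)$ for all $t\in\mathbb{R}$, $z\in\mathbb{R}^N$. Write $[t]^{p-1}:=|t|^{p-2}t$. Let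 $u,v\in W^{1,p}_0(\Omega)$ satisfy $u>0$ and $v>0$ a.e. in $\Omega$, $u/v,\,v/u\in L^\infty(\Omega)$, and $\int_{\omega\cap\Omega}\mathcal H(x,\nabla u)\,dx<\infty$, $\int_{\omega\cap\Omega}\mathcal H(x,\nabla v)\,dx<\infty$. Put $$\varphi:=\frac{u^{r+1}-v^{r+1}}{u^{r}},\qquad \psi:=\frac{v^{r+1}-u^{r+1}}{v^{r}}\quad\text{in }\Omega,\qquad \varphi=\psi=0\ \text{ in }\mathbb{R}^N\setminus\Omega .$$ Then $\varphi,\psi\in W^{1,p}_0(\Omega)$, the four integrals below converge absolutely, and $$\begin{aligned} D:={}&\int_{\omega\cap\Omega}\nabla_z\mathcal H(x,\nabla u)\cdot\nabla\varphi\,dx+\int_{\omega\cap\Omega}\nabla_z\mathcal H(x,\nabla v)\cdot\nabla\psi\,dx\\ &+\iint_{\omega\times\omega}K(x,y)\,[u(x)-u(y)]^{p-1}\big(\varphi(x)-\varphi(y)\big)\,dx\,dy\\ &+\iint_{\omega\times\omega}K(x,y)\,[v(x)-v(y)]^{p-1}\big(\psi(x)-\psi(y)\big)\,dx\,dy\ \ge\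 0 . \end{aligned}$$ Moreover, if $D=0$, then: \begin{itemize} \item[(i)] there is a constant $c>0$ with $u/v=c$ a.e. in $\omega\cap\Omega$; \item[(ii)] if in addition $r+1\neq p$, then $u=v$ a.e. in $\omega\cap\Omega$, unless $u$ and $v$ are both a.e. equal to constants on $\omega$. \end{itemize} In particular, if $D=0$ and $|\Omega\setminus\omega|=0$ (for example $\omega=\Omega$ or $\omega=\mathbb{R}^N$), then $u/v$ is a.e. equal to a positive constant in $\Omega$, and $u=v$ a.e. in $\Omega$ if $r+1\neq p$. -/

import Mathlib

open MeasureTheory Set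
open scoped ENNReal

noncomputable section

namespace MixedDiazSaa

/-- The Euclidean space `ℝᴺ`. -/
abbrev E (N : ℕ) : Type := EuclideanSpace ℝ (Fin N)

/-- `g` is a weak (distributional) gradient of `u` on `ℝᴺ`. -/
def IsWeakGrad {N : ℕ} (u : E N → ℝ) (g : E N → E N) : Prop :=
  LocallyIntegrable u volume ∧ LocallyIntegrable g volume ∧
    ∀ η : E N → ℝ, ContDiff ℝ ((⊤ : ℕ∞) : WithTop ℕ∞) η → HasCompactSupport η → ∀ e : E N,
      ∫ x, u x * fderiv ℝ η x e = - ∫ x, inner ℝ (g x) e * η x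

open Classical in
/-- The weak gradient of `u` (unique up to null sets when it exists, and `0` otherwise). -/
def weakGrad {N : ℕ} (u : E N → ℝ) : E N → E N :=
  if h : ∃ g, IsWeakGrad u g then h.choose else 0

/-- `u ∈ W^{1,p}(ℝᴺ)`. -/
def MemW1p {N : ℕ} (p : ℝ) (u : E N → ℝ) : Prop :=
  MemLp u (ENNReal.ofReal p) volume ∧
    ∃ g, IsWeakGrad u g ∧ MemLp g (ENNReal.ofReal p) volume

/-- `u ∈ W₀^{1,p}(Ω)`, functions on `Ω` being identified with their extension by zero:
`u ∈ W^{1,p}(ℝᴺ)` and `u = 0` a.e. in `ℝᴺ \ Ω`. -/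
def MemW01p {N : ℕ} (p : ℝ) (Ω : Set (E N)) (u : E N → ℝ) : Prop :=
  MemW1p p u ∧ ∀ᵐ x ∂(volume.restrict Ωᶜ), u x = 0

/-- The conditions on the local density `H : Ω × ℝᴺ → [0, ∞)`: it is a Carathéodory function,
`C¹`, convex and `p`-homogeneous in the second variable. -/
structure IsLocalDensity {N : ℕ} (p : ℝ) (Ω : Set (E N)) (H : E N → E N → ℝ) : Prop where
  measurable : ∀ z, AEMeasurable (fun x => H x z) (volume.restrict Ω)
  contDiff : ∀ᵐ x ∂(volume.restrict Ω), ContDiff ℝ 1 (H x)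
  nonneg : ∀ᵐ x ∂(volume.restrict Ω), ∀ z, 0 ≤ H x z
  convex : ∀ᵐ x ∂(volume.restrict Ω), ConvexOn ℝ univ (H x)
  homogeneous : ∀ᵐ x ∂(volume.restrict Ω), ∀ (t : ℝ) (z : E N), H x (t • z) = |t| ^ p * H x z

/-- The product measure `dx dy` on `ω × ω`. -/
def pairMeasure {N : ℕ} (ω : Set (E N)) : Measure (E N × E N) :=
  (volume.restrict ω).prod (volume.restrict ω)

/-- The conditions on the kernel `K : ω × ω → [0, ∞)`: it is measurable, symmetric and
comparable with `κ |x - y|^{-(N + s p)}`. -/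
structure IsKernel {N : ℕ} (p s κ Λ : ℝ) (ω : Set (E N)) (K : E N → E N → ℝ) : Prop where
  measurable : AEMeasurable (fun z : E N × E N => K z.1 z.2) (pairMeasure ω)
  symm : ∀ᵐ z ∂(pairMeasure ω), K z.1 z.2 = K z.2 z.1
  lower : ∀ᵐ z ∂(pairMeasure ω), κ / (Λ * ‖z.1 - z.2‖ ^ ((N : ℝ) + s * p)) ≤ K z.1 z.2
  upper : ∀ᵐ z ∂(pairMeasure ω), K z.1 z.2 ≤ κ * Λ / ‖z.1 - z.2‖ ^ ((N : ℝ) + s * p)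

/-- The signed power `[t]^{p-1} = |t|^{p-2} t`. -/
def spow (p t : ℝ) : ℝ := |t| ^ (p - 2) * t

/-- The test function `(u^{r+1} - v^{r+1}) / u^r`. Where `u = v = 0` (outside the domain) it has
the value `0`, so it is automatically extended by zero. -/
def testFn {N : ℕ} (r : ℝ) (u v : E N → ℝ) : E N → ℝ :=
  fun x => (u x ^ (r + 1) - v x ^ (r + 1)) / u x ^ r

/-- The integrand `∇_z H(x, ∇u) · ∇φ` of the local term. -/
def localDensity {N : ℕ} (H : E N → E N → ℝ) (u φ : E N → ℝ) : E N → ℝ :=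
  fun x => inner ℝ (gradient (H x) (weakGrad u x)) (weakGrad φ x)

/-- The integrand `K(x, y) [u(x) - u(y)]^{p-1} (φ(x) - φ(y))` of the nonlocal term. -/
def nonlocalDensity {N : ℕ} (p : ℝ) (K : E N → E N → ℝ) (u φ : E N → ℝ) : E N × E N → ℝ :=
  fun z => K z.1 z.2 * spow p (u z.1 - u z.2) * (φ z.1 - φ z.2)

/-- The left-hand side of the generalized Díaz–Saa inequality on `ω`. The density `H` is given on
`Ω` only, so the local terms are integrated over `ω ∩ Ω`; the functions vanish outside `Ω`. -/
def diazSaa {N : ℕ} (p r : ℝ) (Ω ω : Set (E N)) (H : E N → E N → ℝ) (K : E N → E N → ℝ)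
    (u v : E N → ℝ) : ℝ :=
  (∫ x in ω ∩ Ω, localDensity H u (testFn r u v) x)
    + (∫ x in ω ∩ Ω, localDensity H v (testFn r v u) x)
    + (∫ z, nonlocalDensity p K u (testFn r u v) z ∂(pairMeasure ω))
    + (∫ z, nonlocalDensity p K v (testFn r v u) z ∂(pairMeasure ω))

end MixedDiazSaa

end

/-! Everything rests on pointwise inequalities. With `persp r a b = b^(r+1) a^(-r)`, the test
function is `φ = u - persp r u v`. As the perspective of the convex power `t^(r+1)`, `persp` is
1-homogeneous and lies above the planes `(r+1) w^r b - r w^(r+1) a`, touching each only along the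
ray `b = w a`.

Nonlocal term: taking `w` to be the ratio at one of the two points gives the discrete Picone
inequality `spow_mul_persp_sub_le`. Adding it to its mirror image, with `X = |u(x) - u(y)|` and `Y =
|v(x) - v(y)|`, bounds the sum of the integrands below by `K (X^(r+1) - Y^(r+1)) (X^(p-r-1) -
Y^(p-r-1)) ≥ 0` (`discrete_diazSaa`).

Local term: convexity, Euler's identity and weighted AM-GM give `∇H(∇u)·∇φ ≥ (r+1)(H(∇u) - H(∇v))`
(`picone`); adding the bound with `u` and `v` exchanged cancels the right-hand sides.

Equality: both sums are nonnegative, so `D = 0` makes the nonlocal integrand vanish a.e., and this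
alone gives rigidity. Off the diagonal `K > 0`, hence `u(x) v(y) = u(y) v(x)`, so `u = c v`; if `r +
1 ≠ p` also `X = Y`, so `c = 1` or `v` is constant on `ω`. When `ω` fills `Ω`, constants are
excluded because a nonzero multiple of the indicator of a non-null set is not in `W^{1,p}`.

The analytic work is `φ ∈ W^{1,p}` with the expected gradient. `φ` is a Lipschitz function of `(u,
v)` on the cone where the ratios are bounded, but is not differentiable at the origin. The chain
rule is therefore proved through difference quotients, using that the gradients of `u` and `v`
vanish a.e. where the functions do. -/

namespace MixedDiazSaa

open Filter Topology

set_option linter.unusedSectionVars false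

/-! ### Translations in `L^P` and weak derivatives. -/

section Translation

variable {V : Type*} [NormedAddCommGroup V] [NormedSpace ℝ V] [FiniteDimensional ℝ V]
  [MeasurableSpace V] [BorelSpace V] {μ : Measure V} [μ.IsAddHaarMeasure]

/-- `d` is a weak derivative of `u` in the direction `e`. -/
def HasWeakDeriv (μ : Measure V) (u d : V → ℝ) (e : V) : Prop :=
  ∀ η : V → ℝ, ContDiff ℝ ((⊤ : ℕ∞) : WithTop ℕ∞) η → HasCompactSupport η →
    ∫ x, u x * fderiv ℝ η x e ∂μ = - ∫ x, d x * η x ∂μ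

/-- The translation operator `f ↦ f (h + ·)` on `L^P`. -/
def transl (P : ℝ≥0∞) [Fact (1 ≤ P)] (μ : Measure V) [μ.IsAddHaarMeasure] (h : V) :
    Lp ℝ P μ →ₗᵢ[ℝ] Lp ℝ P μ :=
  Lp.compMeasurePreservingₗᵢ ℝ (fun x => h + x) (measurePreserving_add_left μ h)

variable {P : ℝ≥0∞} [Fact (1 ≤ P)]

lemma coeFn_transl (h : V) (f : Lp ℝ P μ) : transl P μ h f =ᵐ[μ] fun x => f (h + x) :=
  Lp.coeFn_compMeasurePreserving f (measurePreserving_add_left μ h)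

lemma transl_zero (f : Lp ℝ P μ) : transl P μ 0 f = f := by
  apply Lp.ext
  filter_upwards [coeFn_transl 0 f] with x hx
  simpa using hx

lemma continuous_transl (hP : P ≠ ∞) (f : Lp ℝ P μ) : Continuous fun h => transl P μ h f :=
  Continuous.compMeasurePreservingLp (f := fun _ : V => f)
    (g := fun h : V => ⟨fun x => h + x, by fun_prop⟩) continuous_const
    (ContinuousMap.curry ⟨fun z : V × V => z.1 + z.2, by fun_prop⟩).continuous
    (fun h => measurePreserving_add_left μ h) hP

/-- Makes testing against `η` a continuous functional on `L^P`, so that it commutes with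
vector-valued integrals. -/
lemma exists_clm_integral_mul {η : V → ℝ} (hη : Continuous η) (hc : HasCompactSupport η) :
    ∃ T : Lp ℝ P μ →L[ℝ] ℝ, ∀ f : Lp ℝ P μ, T f = ∫ x, f x * η x ∂μ := by
  have : ENNReal.HolderConjugate P P.conjExponent := .conjExponent Fact.out
  have hm : MemLp η P.conjExponent μ := hη.memLp_of_hasCompactSupport hc
  have : Fact (1 ≤ P.conjExponent) := ⟨by
    have := ENNReal.HolderConjugate.one_le P.conjExponent P
    exact this⟩
  refine ⟨((ContinuousLinearMap.mul ℝ ℝ).lpPairing μ P P.conjExponent).flip hm.toLp, fun f => ?_⟩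
  rw [ContinuousLinearMap.flip_apply, ContinuousLinearMap.lpPairing_eq_integral]
  refine integral_congr_ae ?_
  filter_upwards [hm.coeFn_toLp] with x hx
  simp [hx]

/-- The integral is the convolution of `u` with `η(-·)` at `t • e`, so the derivative can be put on
`η` and `u` need only be locally integrable. -/
lemma hasDerivAt_integral_translate_mul {u η : V → ℝ} (hu : LocallyIntegrable u μ)
    (hη : ContDiff ℝ 1 η) (hc : HasCompactSupport η) (e : V) (t : ℝ) :
    HasDerivAt (fun t : ℝ => ∫ x, u (t • e + x) * η x ∂μ)
      (- ∫ x, u x * fderiv ℝ η (x - t • e) e ∂μ) t := by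
  set g : V → ℝ := fun z => η (-z) with hg
  have hgc : HasCompactSupport g := hc.comp_homeomorph (Homeomorph.neg V)
  have hgd : ContDiff ℝ 1 g := hη.comp contDiff_neg
  have h1 := hgc.hasFDerivAt_convolution_right (ContinuousLinearMap.mul ℝ ℝ) hu hgd (t • e)
  have h2 : HasDerivAt (fun t : ℝ => t • e) e t := by
    simpa using (hasDerivAt_id t).smul_const e
  have h3 := h1.comp_hasDerivAt t h2
  have hfd : ∀ z, fderiv ℝ g z = - fderiv ℝ η (-z) := fun z => by
    have := ((hη.differentiable one_ne_zero (-z)).hasFDerivAt).comp z (hasFDerivAt_id z).neg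
    refine this.fderiv.trans ?_
    ext v
    simp
  have hint : ConvolutionExistsAt u (fderiv ℝ g) (t • e)
      ((ContinuousLinearMap.mul ℝ ℝ).precompR V) μ :=
    (hgc.fderiv ℝ).convolutionExists_right _ hu (hgd.continuous_fderiv one_ne_zero) _
  have hfun : (fun t : ℝ => ∫ x, u (t • e + x) * η x ∂μ) =
      (convolution u g (ContinuousLinearMap.mul ℝ ℝ) μ) ∘ fun t : ℝ => t • e := by
    ext s
    simp only [Function.comp_apply, convolution_def, ContinuousLinearMap.mul_apply', hg]
    rw [← integral_add_left_eq_self (fun t => u t * η (-(s • e - t))) (s • e)]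
    simp
  rw [hfun]
  refine h3.congr_deriv ?_
  rw [convolution_def, ContinuousLinearMap.integral_apply hint, ← integral_neg]
  refine integral_congr_ae (Eventually.of_forall fun x => ?_)
  simp [ContinuousLinearMap.precompR_apply, hfd]

lemma HasWeakDeriv.hasDerivAt_integral_translate_mul {u d : V → ℝ} {e : V}
    (h : HasWeakDeriv μ u d e) (hu : LocallyIntegrable u μ) {η : V → ℝ}
    (hη : ContDiff ℝ ((⊤ : ℕ∞) : WithTop ℕ∞) η) (hc : HasCompactSupport η) (t : ℝ) :
    HasDerivAt (fun t : ℝ => ∫ x, u (t • e + x) * η x ∂μ)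
      (∫ x, d (t • e + x) * η x ∂μ) t := by
  convert MixedDiazSaa.hasDerivAt_integral_translate_mul hu (hη.of_le (by simp)) hc e t using 1
  have h1 := h (fun x => η (x - t • e)) (hη.comp (contDiff_id.sub contDiff_const))
    (hc.comp_homeomorph (Homeomorph.subRight (t • e)))
  simp only [_root_.fderiv_comp_sub] at h1
  rw [h1, neg_neg, ← integral_add_left_eq_self (fun x => d x * η (x - t • e)) (t • e)]
  simp

lemma integral_transl_mul (h : V) (f : Lp ℝ P μ) (η : V → ℝ) :
    ∫ x, transl P μ h f x * η x ∂μ = ∫ x, f (h + x) * η x ∂μ :=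
  integral_congr_ae (by filter_upwards [coeFn_transl h f] with x hx; rw [hx])

lemma Lp_locallyIntegrable (f : Lp ℝ P μ) : LocallyIntegrable f μ :=
  (Lp.memLp f).locallyIntegrable Fact.out

lemma Lp_ext_of_integral_mul {f g : Lp ℝ P μ}
    (h : ∀ η : V → ℝ, ContDiff ℝ ((⊤ : ℕ∞) : WithTop ℕ∞) η → HasCompactSupport η →
      ∫ x, f x * η x ∂μ = ∫ x, g x * η x ∂μ) : f = g := by
  refine Lp.ext (ae_eq_of_integral_contDiff_smul_eq (Lp_locallyIntegrable f)
    (Lp_locallyIntegrable g) fun η hη hc => ?_)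
  simpa [smul_eq_mul, mul_comm] using h η hη hc

/-- Translates of a function with a weak derivative form a differentiable curve in `L^P`. -/
lemma HasWeakDeriv.hasDerivAt_transl (hP : P ≠ ∞) {u d : Lp ℝ P μ} {e : V}
    (h : HasWeakDeriv μ u d e) (t : ℝ) :
    HasDerivAt (fun t : ℝ => transl P μ (t • e) u) (transl P μ (t • e) d) t := by
  have hcont : Continuous fun s : ℝ => transl P μ (s • e) d :=
    (continuous_transl hP d).comp (by fun_prop)
  -- Fundamental theorem of calculus in `L^P`, checked against test functions. The integrand is norm
  -- continuous, which turns weak differentiability into strong differentiability.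
  have key : ∀ t : ℝ, transl P μ (t • e) u = u + ∫ s in (0 : ℝ)..t, transl P μ (s • e) d := by
    intro t
    refine Lp_ext_of_integral_mul fun η hη hc => ?_
    obtain ⟨T, hT⟩ := exists_clm_integral_mul (μ := μ) (P := P) hη.continuous hc
    rw [← hT, ← hT, map_add, ← T.intervalIntegral_comp_comm (hcont.intervalIntegrable _ _)]
    have hd : ∀ s : ℝ, HasDerivAt (fun s : ℝ => T (transl P μ (s • e) u))
        (T (transl P μ (s • e) d)) s := by
      intro s
      simp only [hT, integral_transl_mul]
      exact h.hasDerivAt_integral_translate_mul (Lp_locallyIntegrable u) hη hc s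
    rw [intervalIntegral.integral_eq_sub_of_hasDerivAt (fun s _ => hd s)
      ((T.continuous.comp hcont).intervalIntegrable _ _)]
    simp [transl_zero]
  rw [funext key]
  exact (intervalIntegral.integral_hasDerivAt_right (hcont.intervalIntegrable _ _)
    (hcont.stronglyMeasurableAtFilter _ _) hcont.continuousAt).const_add u

/-- Mean value inequality: translations are isometries, so the derivative of the curve has constant
norm `‖d‖`. -/
lemma HasWeakDeriv.norm_transl_sub_le (hP : P ≠ ∞) {u d : Lp ℝ P μ} {e : V}
    (h : HasWeakDeriv μ u d e) : ‖transl P μ e u - u‖ ≤ ‖d‖ := by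
  have := norm_image_sub_le_of_norm_deriv_le_segment_01' (C := ‖d‖)
    (fun t _ => (h.hasDerivAt_transl hP t).hasDerivWithinAt)
    (fun t _ => ((transl P μ (t • e)).norm_map d).le)
  simpa [transl_zero] using this

/-- If difference quotients of `u` converge weakly to `d`, then `d` is a weak derivative. -/
lemma hasWeakDeriv_of_tendsto {u d : V → ℝ} {e : V} (hu : LocallyIntegrable u μ)
    {t : ℕ → ℝ} (ht : Tendsto t atTop (𝓝[≠] 0))
    (h : ∀ η : V → ℝ, ContDiff ℝ ((⊤ : ℕ∞) : WithTop ℕ∞) η → HasCompactSupport η →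
      Tendsto (fun n => ∫ x, (t n)⁻¹ * (u (t n • e + x) - u x) * η x ∂μ) atTop
        (𝓝 (∫ x, d x * η x ∂μ))) :
    HasWeakDeriv μ u d e := by
  intro η hη hc
  have h1 := MixedDiazSaa.hasDerivAt_integral_translate_mul hu (hη.of_le (by simp)) hc e 0
  rw [hasDerivAt_iff_tendsto_slope_zero] at h1
  have h2 := h1.comp ht
  have h3 := h η hη hc
  have hloc : ∀ s : ℝ, LocallyIntegrable (fun x => u (s • e + x)) μ := fun s => by
    have := (measurePreserving_add_left μ (s • e))
    rw [← this.map_eq] at hu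
    exact (locallyIntegrable_map_homeomorph (Homeomorph.addLeft (s • e))).1 hu
  have heq : ∀ n, ∫ x, (t n)⁻¹ * (u (t n • e + x) - u x) * η x ∂μ =
      ((fun s : ℝ => s⁻¹ • ((∫ x, u ((0 + s) • e + x) * η x ∂μ)
        - ∫ x, u ((0 : ℝ) • e + x) * η x ∂μ)) ∘ t) n := by
    intro n
    have i1 : ∀ s : ℝ, Integrable (fun x => u (s • e + x) * η x) μ := fun s => by
      simpa [mul_comm] using (hloc s).integrable_smul_left_of_hasCompactSupport hη.continuous hc
    simp only [Function.comp_apply, zero_add, smul_eq_mul]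
    rw [← integral_sub (i1 _) (i1 _), ← integral_const_mul]
    refine integral_congr_ae (Eventually.of_forall fun x => ?_)
    simp; ring
  have h4 := tendsto_nhds_unique (h3.congr heq) h2
  simp at h4
  rw [h4, neg_neg]

end Translation

/-! ### Chain rule by difference quotients. -/

/-- Dominated convergence with dominating functions that converge in `L¹`. -/
lemma tendsto_integral_of_dominated_of_tendsto {α : Type*} [MeasurableSpace α] {μ : Measure α}
    {f g : ℕ → α → ℝ} {F G : α → ℝ} (hf : ∀ n, AEStronglyMeasurable (f n) μ)
    (hg : ∀ n, Integrable (g n) μ) (hG : Integrable G μ)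
    (hfg : ∀ n, ∀ᵐ x ∂μ, |f n x| ≤ g n x)
    (hfF : ∀ᵐ x ∂μ, Tendsto (fun n => f n x) atTop (𝓝 (F x)))
    (hgG : ∀ᵐ x ∂μ, Tendsto (fun n => g n x) atTop (𝓝 (G x)))
    (hL1 : Tendsto (fun n => ∫ x, |g n x - G x| ∂μ) atTop (𝓝 0)) :
    Tendsto (fun n => ∫ x, f n x ∂μ) atTop (𝓝 (∫ x, F x ∂μ)) := by
  have hFG : ∀ᵐ x ∂μ, |F x| ≤ G x := by
    filter_upwards [hfF, hgG, ae_all_iff.2 hfg] with x h1 h2 h3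
    exact le_of_tendsto_of_tendsto' h1.abs h2 h3
  -- Truncated to `[-G, G]`, the sequence obeys ordinary dominated convergence; the truncation error
  -- is at most `|g n - G|`.
  set c : ℕ → α → ℝ := fun n x => max (-G x) (min (f n x) (G x)) with hc
  have hcm : ∀ n, AEStronglyMeasurable (c n) μ := fun n =>
    hG.1.neg.sup ((hf n).inf hG.1)
  have hcG : ∀ n, ∀ᵐ x ∂μ, ‖c n x‖ ≤ G x := fun n => by
    filter_upwards [hFG] with x hx
    have h0 : 0 ≤ G x := (abs_nonneg _).trans hx
    rw [Real.norm_eq_abs, abs_le]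
    exact ⟨le_max_left _ _, max_le (by linarith) (min_le_right _ _)⟩
  have hcF : ∀ᵐ x ∂μ, Tendsto (fun n => c n x) atTop (𝓝 (F x)) := by
    filter_upwards [hFG, hfF] with x hx h1
    have h2 : Tendsto (fun n => c n x) atTop (𝓝 (max (-G x) (min (F x) (G x)))) :=
      tendsto_const_nhds.max (h1.min tendsto_const_nhds)
    rwa [min_eq_left (le_of_abs_le hx), max_eq_right (neg_le_of_abs_le hx)] at h2
  have h1 := tendsto_integral_of_dominated_convergence G hcm hG hcG hcF
  have hfi : ∀ n, Integrable (f n) μ := fun n => (hg n).mono' (hf n) (hfg n)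
  have hci : ∀ n, Integrable (c n) μ := fun n => hG.mono' (hcm n) (hcG n)
  have h2 : Tendsto (fun n => ∫ x, f n x ∂μ - ∫ x, c n x ∂μ) atTop (𝓝 0) := by
    refine squeeze_zero_norm (fun n => ?_) hL1
    rw [← integral_sub (hfi n) (hci n)]
    refine (norm_integral_le_integral_norm _).trans
      (integral_mono_ae ((hfi n).sub (hci n)).norm ((hg n).sub hG).abs ?_)
    filter_upwards [hfg n, hFG] with x h3 h4
    have h0 : 0 ≤ G x := (abs_nonneg _).trans h4
    have h5 := le_abs_self (g n x - G x)
    have h6 := abs_nonneg (g n x - G x)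
    obtain ⟨h7, h8⟩ := abs_le.1 h3
    simp only [Real.norm_eq_abs, hc]
    rw [abs_le]
    constructor <;> rcases max_cases (-G x) (min (f n x) (G x)) with h | h <;>
      rcases min_cases (f n x) (G x) with h' | h' <;> linarith
  simpa using h2.add h1

section Chain

variable {V : Type*} [NormedAddCommGroup V] [NormedSpace ℝ V] [FiniteDimensional ℝ V]
  [MeasurableSpace V] [BorelSpace V] {μ : Measure V} [μ.IsAddHaarMeasure]
  {P : ℝ≥0∞} [Fact (1 ≤ P)]

lemma HasWeakDeriv.congr {u d u' d' : V → ℝ} {e : V} (h : HasWeakDeriv μ u d e)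
    (hu : u =ᵐ[μ] u') (hd : d =ᵐ[μ] d') : HasWeakDeriv μ u' d' e := by
  intro η hη hc
  rw [← integral_congr_ae (f := fun x => u x * fderiv ℝ η x e)
      (by filter_upwards [hu] with x hx; rw [hx]), h η hη hc,
    integral_congr_ae (f := fun x => d x * η x)
      (by filter_upwards [hd] with x hx; rw [hx])]

lemma ae_translate {p : V → Prop} (h : ∀ᵐ x ∂μ, p x) (a : V) : ∀ᵐ x ∂μ, p (a + x) :=
  (measurePreserving_add_left μ a).quasiMeasurePreserving.ae h

lemma HasWeakDeriv.tendsto_Lp (hP : P ≠ ∞) {u d : Lp ℝ P μ} {e : V}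
    (h : HasWeakDeriv μ u d e) {t : ℕ → ℝ} (ht : Tendsto t atTop (𝓝[≠] 0)) :
    Tendsto (fun n => (t n)⁻¹ • (transl P μ (t n • e) u - u)) atTop (𝓝 d) := by
  have h1 := h.hasDerivAt_transl hP 0
  rw [hasDerivAt_iff_tendsto_slope_zero] at h1
  simpa [transl_zero, Function.comp_def] using h1.comp ht

lemma coeFn_smul_transl_sub (c : ℝ) (h : V) (u : Lp ℝ P μ) :
    (c • (transl P μ h u - u) : Lp ℝ P μ) =ᵐ[μ] fun x => c * (u (h + x) - u x) := by
  filter_upwards [Lp.coeFn_smul c (transl P μ h u - u), Lp.coeFn_sub (transl P μ h u) u,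
    coeFn_transl h u] with x h1 h2 h3
  rw [h1, Pi.smul_apply, h2, Pi.sub_apply, h3, smul_eq_mul]

/-- Chain rule: if `φ` has increments bounded by those of `u` and `v`, then an a.e. limit of its
difference quotients is a weak derivative. -/
lemma HasWeakDeriv.of_increments (hP : P ≠ ∞) {u du v dv φ δ : V → ℝ} {e : V}
    (hu : MemLp u P μ) (hdu : MemLp du P μ) (hv : MemLp v P μ) (hdv : MemLp dv P μ)
    (hφ : MemLp φ P μ)
    (hude : HasWeakDeriv μ u du e) (hvde : HasWeakDeriv μ v dv e) {C : ℝ} (hC : 0 ≤ C)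
    (hinc : ∀ h : V, ∀ᵐ x ∂μ, |φ (h + x) - φ x| ≤ C * (|u (h + x) - u x| + |v (h + x) - v x|))
    (hlim : ∀ t : ℕ → ℝ, (∀ n, 0 < t n) → Tendsto t atTop (𝓝 0) → ∀ᵐ x ∂μ,
      Tendsto (fun n => (t n)⁻¹ * (u (t n • e + x) - u x)) atTop (𝓝 (du x)) →
      Tendsto (fun n => (t n)⁻¹ * (v (t n • e + x) - v x)) atTop (𝓝 (dv x)) →
      Tendsto (fun n => (t n)⁻¹ * (φ (t n • e + x) - φ x)) atTop (𝓝 (δ x))) :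
    HasWeakDeriv μ φ δ e := by
  set t₀ : ℕ → ℝ := fun n => 1 / ((n : ℝ) + 1) with ht₀
  have hpos₀ : ∀ n, 0 < t₀ n := fun n => by positivity
  have hne : ∀ t : ℕ → ℝ, (∀ n, 0 < t n) → Tendsto t atTop (𝓝 0) → Tendsto t atTop (𝓝[≠] 0) :=
    fun t h1 h2 => tendsto_nhdsWithin_iff.2 ⟨h2, Eventually.of_forall fun n => (h1 n).ne'⟩
  have hu' : HasWeakDeriv μ (hu.toLp u) (hdu.toLp du) e := hude.congr hu.coeFn_toLp.symm hdu.coeFn_toLp.symm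
  have hv' : HasWeakDeriv μ (hv.toLp v) (hdv.toLp dv) e := hvde.congr hv.coeFn_toLp.symm hdv.coeFn_toLp.symm
  -- Convergence in `L^P` gives a.e. convergence only along a subsequence; two successive
  -- extractions serve `u` and `v` together.
  obtain ⟨n₁, hn₁, hae₁⟩ := (tendstoInMeasure_of_tendsto_Lp
    (hu'.tendsto_Lp hP (hne t₀ hpos₀ tendsto_one_div_add_atTop_nhds_zero_nat))).exists_seq_tendsto_ae
  obtain ⟨n₂, hn₂, hae₂⟩ := (tendstoInMeasure_of_tendsto_Lp
    (hv'.tendsto_Lp hP (hne (t₀ ∘ n₁) (fun n => hpos₀ _)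
      (tendsto_one_div_add_atTop_nhds_zero_nat.comp hn₁.tendsto_atTop)))).exists_seq_tendsto_ae
  set t : ℕ → ℝ := fun n => t₀ (n₁ (n₂ n)) with ht
  have hpos : ∀ n, 0 < t n := fun n => hpos₀ _
  have htend : Tendsto t atTop (𝓝 0) :=
    tendsto_one_div_add_atTop_nhds_zero_nat.comp (hn₁.comp hn₂).tendsto_atTop
  have hconv : ∀ {w : V → ℝ} (hw : MemLp w P μ) (n : ℕ),
      ((t n)⁻¹ • (transl P μ (t n • e) (hw.toLp w) - (hw.toLp w)) : Lp ℝ P μ) =ᵐ[μ]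
        fun x => (t n)⁻¹ * (w (t n • e + x) - w x) := by
    intro w hw n
    filter_upwards [coeFn_smul_transl_sub (t n)⁻¹ (t n • e) (hw.toLp w), hw.coeFn_toLp,
      ae_translate hw.coeFn_toLp (t n • e)] with x h1 h2 h3
    rw [h1, h2, h3]
  have haeu : ∀ᵐ x ∂μ,
      Tendsto (fun n => (t n)⁻¹ * (u (t n • e + x) - u x)) atTop (𝓝 (du x)) := by
    filter_upwards [hae₁, hdu.coeFn_toLp, ae_all_iff.2 (hconv hu)] with x h1 h2 h3
    rw [← h2]
    exact (h1.comp hn₂.tendsto_atTop).congr h3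
  have haev : ∀ᵐ x ∂μ,
      Tendsto (fun n => (t n)⁻¹ * (v (t n • e + x) - v x)) atTop (𝓝 (dv x)) := by
    filter_upwards [hae₂, hdv.coeFn_toLp, ae_all_iff.2 (hconv hv)] with x h1 h2 h3
    rw [← h2]
    exact h1.congr h3
  refine hasWeakDeriv_of_tendsto (hφ.locallyIntegrable Fact.out) (hne t hpos htend)
    fun η hη hc => ?_
  have hηc : HasCompactSupport fun x => |η x| := by
    simpa using hc.norm
  obtain ⟨T, hT⟩ := exists_clm_integral_mul (μ := μ) (P := P) hη.continuous.abs hηc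
  have hint : ∀ f : Lp ℝ P μ, Integrable (fun x => f x * |η x|) μ := fun f => by
    simpa [mul_comm] using (Lp_locallyIntegrable f).integrable_smul_left_of_hasCompactSupport
      hη.continuous.abs hηc
  have hintabs : ∀ f : Lp ℝ P μ, Integrable (fun x => |f x| * |η x|) μ := fun f => by
    simpa [abs_mul] using (hint f).abs
  have hL1 : ∀ {f : ℕ → Lp ℝ P μ} {g : Lp ℝ P μ}, Tendsto f atTop (𝓝 g) →
      Tendsto (fun n => ∫ x, |f n x - g x| * |η x| ∂μ) atTop (𝓝 0) := by
    intro f g hfg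
    have h1 : Tendsto (fun n => ‖T‖ * ‖f n - g‖) atTop (𝓝 0) := by
      simpa using (tendsto_iff_norm_sub_tendsto_zero.1 hfg).const_mul ‖T‖
    refine squeeze_zero_norm (fun n => ?_) h1
    have h2 : ∫ x, |f n x - g x| * |η x| ∂μ = T |f n - g| := by
      rw [hT]
      refine integral_congr_ae ?_
      filter_upwards [Lp.coeFn_abs (f n - g), Lp.coeFn_sub (f n) g] with x h3 h4
      rw [h3, h4, Pi.sub_apply]
    rw [h2, ← norm_abs_eq_norm (f n - g)]
    exact T.le_opNorm _
  set Du : ℕ → Lp ℝ P μ := fun n => (t n)⁻¹ • (transl P μ (t n • e) (hu.toLp u) - (hu.toLp u)) with hDu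
  set Dv : ℕ → Lp ℝ P μ := fun n => (t n)⁻¹ • (transl P μ (t n • e) (hv.toLp v) - (hv.toLp v)) with hDv
  have hLu := hL1 (hu'.tendsto_Lp hP (hne t hpos htend))
  have hLv := hL1 (hv'.tendsto_Lp hP (hne t hpos htend))
  have hmφ : ∀ n, AEStronglyMeasurable (fun x => (t n)⁻¹ * (φ (t n • e + x) - φ x) * η x) μ :=
    fun n => (((hφ.1.comp_quasiMeasurePreserving
      (measurePreserving_add_left μ (t n • e)).quasiMeasurePreserving).sub hφ.1).const_mul _).mul
      hη.continuous.aestronglyMeasurable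
  -- The quotients of `φ` are dominated by those of `u` and `v`, which vary with `n` but converge
  -- strongly in `L^P`, hence in `L¹` with weight `|η|`.
  refine tendsto_integral_of_dominated_of_tendsto
    (g := fun n x => C * (|Du n x| * |η x| + |Dv n x| * |η x|))
    (G := fun x => C * (|(hdu.toLp du) x| * |η x| + |(hdv.toLp dv) x| * |η x|)) hmφ
    (fun n => ((hintabs _).add (hintabs _)).const_mul _)
    (((hintabs _).add (hintabs _)).const_mul _) (fun n => ?_) ?_ ?_ ?_
  · filter_upwards [hconv hu n, hconv hv n, hinc (t n • e)] with x h1 h2 h3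
    have h4 := inv_pos.2 (hpos n)
    rw [hDu, hDv]
    simp only [h1, h2, abs_mul, abs_of_pos h4]
    calc (t n)⁻¹ * |φ (t n • e + x) - φ x| * |η x|
        ≤ (t n)⁻¹ * (C * (|u (t n • e + x) - u x| + |v (t n • e + x) - v x|)) * |η x| := by
          gcongr
      _ = _ := by ring
  · filter_upwards [hlim t hpos htend, haeu, haev] with x h1 h2 h3
    exact (h1 h2 h3).mul_const _
  · filter_upwards [haeu, haev, ae_all_iff.2 (hconv hu), ae_all_iff.2 (hconv hv),
      hdu.coeFn_toLp, hdv.coeFn_toLp] with x h1 h2 h3 h4 h5 h6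
    rw [h5, h6]
    refine ((Tendsto.mul_const _ ?_).add (Tendsto.mul_const _ ?_)).const_mul C
    · exact (h1.congr fun n => (h3 n).symm).abs
    · exact (h2.congr fun n => (h4 n).symm).abs
  · have h1 : Tendsto (fun n => C * (∫ x, |Du n x - (hdu.toLp du) x| * |η x| ∂μ
        + ∫ x, |Dv n x - (hdv.toLp dv) x| * |η x| ∂μ)) atTop (𝓝 0) := by
      simpa using (hLu.add hLv).const_mul C
    have hi : ∀ f g : Lp ℝ P μ, Integrable (fun x => |f x - g x| * |η x|) μ := fun f g => by
      simpa [← sub_mul, abs_mul] using ((hint f).sub (hint g)).abs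
    refine squeeze_zero (fun n => integral_nonneg fun x => abs_nonneg _) (fun n => ?_) h1
    rw [← integral_add (hi _ _) (hi _ _), ← integral_const_mul]
    refine integral_mono_ae ((((hintabs _).add (hintabs _)).const_mul _).sub
      (((hintabs _).add (hintabs _)).const_mul _)).abs (((hi _ _).add (hi _ _)).const_mul _)
      (Eventually.of_forall fun x => ?_)
    simp only
    rw [← mul_sub, abs_mul, abs_of_nonneg hC]
    gcongr
    calc _ = abs ((|Du n x| - |(hdu.toLp du) x|) * |η x| + (|Dv n x| - |(hdv.toLp dv) x|) * |η x|) := by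
          ring_nf
      _ ≤ _ := abs_add_le _ _
      _ ≤ _ := by
        rw [abs_mul, abs_mul, abs_abs]
        gcongr ?_ * _ + ?_ * _ <;> exact abs_abs_sub_abs_le_abs_sub _ _

/-- A function has nonnegative directional weak derivatives where it attains its minimum. -/
lemma HasWeakDeriv.nonneg_of_eq_min (hP : P ≠ ∞) {u du : V → ℝ} {e : V} (hu : MemLp u P μ)
    (hdu : MemLp du P μ) (h : HasWeakDeriv μ u du e) {c : ℝ} (h0 : ∀ᵐ x ∂μ, c ≤ u x) :
    ∀ᵐ x ∂μ, u x = c → 0 ≤ du x := by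
  have hu' : HasWeakDeriv μ (hu.toLp u) (hdu.toLp du) e :=
    h.congr hu.coeFn_toLp.symm hdu.coeFn_toLp.symm
  set t : ℕ → ℝ := fun n => 1 / ((n : ℝ) + 1) with ht
  have hpos : ∀ n, 0 < t n := fun n => by positivity
  obtain ⟨n₁, hn₁, hae⟩ := (tendstoInMeasure_of_tendsto_Lp
    (hu'.tendsto_Lp hP (tendsto_nhdsWithin_iff.2 ⟨tendsto_one_div_add_atTop_nhds_zero_nat,
      Eventually.of_forall fun n => (hpos n).ne'⟩))).exists_seq_tendsto_ae
  filter_upwards [hae, hdu.coeFn_toLp, hu.coeFn_toLp,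
    ae_all_iff.2 fun n => ae_translate hu.coeFn_toLp (t n • e),
    ae_all_iff.2 fun n => ae_translate h0 (t n • e),
    ae_all_iff.2 fun n => coeFn_smul_transl_sub (t n)⁻¹ (t n • e) (hu.toLp u)]
    with x h1 h2 h3 h4 h5 h6 h7
  rw [← h2]
  -- All steps `t n` are positive and `u x` is the minimum, so every quotient at `x` is nonnegative.
  refine ge_of_tendsto' h1 fun n => ?_
  rw [h6, h3, h4, h7]
  exact mul_nonneg (inv_nonneg.2 (hpos _).le) (sub_nonneg.2 (h5 _))

end Chain

/-! ### Pointwise inequalities for the perspective function. -/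

/-- The pairs `(u x, v x)`: both positive, or both zero. -/
def Adm (a b : ℝ) : Prop := (0 < a ∧ 0 < b) ∨ (a = 0 ∧ b = 0)

lemma Adm.symm {a b : ℝ} (h : Adm a b) : Adm b a := by
  rcases h with ⟨h1, h2⟩ | ⟨h1, h2⟩
  · exact .inl ⟨h2, h1⟩
  · exact .inr ⟨h2, h1⟩

lemma Adm.nonneg {a b : ℝ} (h : Adm a b) : 0 ≤ a := by
  rcases h with ⟨h1, h2⟩ | ⟨h1, h2⟩
  · exact h1.le
  · exact h1.ge

/-- The perspective `a (b / a)^(r+1)` of the power function. -/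
noncomputable def persp (r a b : ℝ) : ℝ := b ^ (r + 1) * a ^ (-r)

variable {r : ℝ}

lemma Adm.testFn_eq (hr : 0 < r) {a b : ℝ} (h : Adm a b) :
    (a ^ (r + 1) - b ^ (r + 1)) / a ^ r = a - persp r a b := by
  rcases h with ⟨h1, h2⟩ | ⟨h1, h2⟩
  · have : 0 < a ^ r := Real.rpow_pos_of_pos h1 r
    rw [persp, Real.rpow_neg h1.le, Real.rpow_add_one h1.ne']
    field_simp
  · subst h1 h2
    simp [persp, Real.zero_rpow (by linarith : r + 1 ≠ 0)]

lemma persp_zero (hr : 0 < r) : persp r 0 0 = 0 := by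
  simp [persp, Real.zero_rpow (by linarith : r + 1 ≠ 0)]

/-- Tangent line inequality for `t ↦ t^(r+1)`, with the case of equality. -/
lemma tangent_rpow (hr : 0 < r) {w w' : ℝ} (hw : 0 < w) (hw' : 0 ≤ w') :
    (r + 1) * w ^ r * w' - r * w ^ (r + 1) ≤ w' ^ (r + 1) ∧
      ((r + 1) * w ^ r * w' - r * w ^ (r + 1) = w' ^ (r + 1) → w' = w) := by
  have hwr : 0 < w ^ r := Real.rpow_pos_of_pos hw r
  have hwq : 0 < w ^ (r + 1) := Real.rpow_pos_of_pos hw _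
  -- After factoring out `w^(r+1)`, the claim is Bernoulli's inequality at `w' / w - 1`, strict
  -- unless this is zero.
  have h1 : (r + 1) * w ^ r * w' - r * w ^ (r + 1) = w ^ (r + 1) * (1 + (r + 1) * (w' / w - 1)) := by
    rw [Real.rpow_add_one hw.ne']
    field_simp
    ring
  have h2 : w' ^ (r + 1) = w ^ (r + 1) * (1 + (w' / w - 1)) ^ (r + 1) := by
    rw [add_sub_cancel, Real.div_rpow hw' hw.le]
    field_simp
  have h3 : -1 ≤ w' / w - 1 := by
    have := div_nonneg hw' hw.le
    linarith
  rw [h1, h2]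
  refine ⟨mul_le_mul_of_nonneg_left
    (one_add_mul_self_le_rpow_one_add h3 (by linarith)) hwq.le, fun h => ?_⟩
  by_contra hne
  have h4 : w' / w - 1 ≠ 0 := fun h0 => hne (by
    have : w' / w = 1 := by linarith
    rwa [div_eq_one_iff_eq hw.ne'] at this)
  exact (one_add_mul_self_lt_rpow_one_add h3 h4 (by linarith)).ne (mul_left_cancel₀ hwq.ne' h)

lemma persp_eq {a b : ℝ} (ha : 0 < a) (hb : 0 ≤ b) :
    persp r a b = a * (b / a) ^ (r + 1) := by
  rw [persp, Real.div_rpow hb ha.le, Real.rpow_neg ha.le, Real.rpow_add_one ha.ne']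
  field_simp

/-- Supporting planes of `persp`. -/
lemma persp_tangent (hr : 0 < r) {w a b : ℝ} (hw : 0 < w) (h : (0 < a ∧ 0 ≤ b) ∨ (a = 0 ∧ b = 0)) :
    (r + 1) * w ^ r * b - r * w ^ (r + 1) * a ≤ persp r a b ∧
      ((r + 1) * w ^ r * b - r * w ^ (r + 1) * a = persp r a b → b = w * a) := by
  rcases h with ⟨ha, hb⟩ | ⟨rfl, rfl⟩
  · have h1 := tangent_rpow hr hw (div_nonneg hb ha.le)
    have h2 : (r + 1) * w ^ r * b - r * w ^ (r + 1) * a =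
        a * ((r + 1) * w ^ r * (b / a) - r * w ^ (r + 1)) := by field_simp
    rw [persp_eq ha hb, h2]
    refine ⟨mul_le_mul_of_nonneg_left h1.1 ha.le, fun h => ?_⟩
    rw [← h1.2 (mul_left_cancel₀ ha.ne' h)]
    field_simp
  · simp [persp_zero hr]

/-- The plane of slope `b / a` touches `persp` at `(a, b)` itself. -/
lemma persp_self {a b : ℝ} (ha : 0 < a) (hb : 0 < b) :
    persp r a b = (r + 1) * (b / a) ^ r * b - r * (b / a) ^ (r + 1) * a := by
  rw [persp_eq ha hb.le, Real.rpow_add_one (div_pos hb ha).ne']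
  field_simp
  ring

/-- Discrete Picone inequality, with the case of equality. -/
lemma spow_mul_persp_sub_le (hr : 0 < r) {p a b c d : ℝ} (hac : Adm a c) (hbd : Adm b d) :
    spow p (a - b) * (persp r a c - persp r b d) ≤ |c - d| ^ (r + 1) * |a - b| ^ (p - (r + 1)) ∧
      (spow p (a - b) * (persp r a c - persp r b d) = |c - d| ^ (r + 1) * |a - b| ^ (p - (r + 1)) →
        a ≠ b → a * d = b * c) := by
  wlog hab : b ≤ a generalizing a b c d
  · have h := this hbd hac (le_of_not_ge hab)
    have h1 : spow p (a - b) * (persp r a c - persp r b d) =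
        spow p (b - a) * (persp r b d - persp r a c) := by
      simp only [spow, abs_sub_comm a b]; ring
    rw [h1, abs_sub_comm a b, abs_sub_comm c d]
    exact ⟨h.1, fun h2 h3 => (h.2 h2 h3.symm).symm⟩
  rcases hab.eq_or_lt with rfl | hab
  · refine ⟨?_, fun _ h => absurd rfl h⟩
    simp only [spow, sub_self, mul_zero, zero_mul]
    positivity
  have hb := hbd.nonneg
  have hd := hbd.symm.nonneg
  have ha : 0 < a := hb.trans_lt hab
  have hc : 0 < c := by
    rcases hac with h | h
    · exact h.2
    · exact absurd h.1 ha.ne'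
  have ht : 0 < a - b := sub_pos.2 hab
  -- With this slope the plane touches at `(a, c)` and lies below `persp` at `(b, d)` and at `(a -
  -- b, |c - d|)`; linearity of the plane combines the three relations.
  set w := c / a with hw
  have hw0 : 0 < w := div_pos hc ha
  have h1 := persp_tangent hr hw0 (a := a - b) (b := |c - d|) (.inl ⟨ht, abs_nonneg _⟩)
  have h2 := persp_tangent hr hw0 (a := b) (b := d) (by
    rcases hbd with h | h
    · exact .inl ⟨h.1, h.2.le⟩
    · exact .inr h)
  have h3 := persp_self (r := r) ha hc
  have h4 : 0 < (r + 1) * w ^ r := by positivity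
  have h5 : (r + 1) * w ^ r * (c - d) ≤ (r + 1) * w ^ r * |c - d| :=
    mul_le_mul_of_nonneg_left (le_abs_self _) h4.le
  have h6 : |c - d| ^ (r + 1) * |a - b| ^ (p - (r + 1)) =
      (a - b) ^ (p - 1) * persp r (a - b) |c - d| := by
    rw [persp, abs_of_pos ht, show p - (r + 1) = (p - 1) + -r by ring, Real.rpow_add ht]
    ring
  have h7 : spow p (a - b) = (a - b) ^ (p - 1) := by
    rw [spow, abs_of_pos ht, show p - 1 = (p - 2) + 1 by ring, Real.rpow_add_one ht.ne']
  have h8 : 0 < (a - b) ^ (p - 1) := Real.rpow_pos_of_pos ht _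
  rw [h6, h7]
  refine ⟨mul_le_mul_of_nonneg_left (by linarith [h1.1, h2.1]) h8.le, fun h _ => ?_⟩
  have h9 := mul_left_cancel₀ h8.ne' h
  -- Overall equality forces contact at `(b, d)` too, so `(b, d)` lies on the ray through `(a, c)`.
  have h10 := h2.2 (le_antisymm h2.1 (by linarith [h1.1]))
  rw [h10, hw]
  field_simp

lemma spow_mul_self {p : ℝ} (hp : 0 < p) (t : ℝ) : spow p t * t = |t| ^ p := by
  rw [spow, mul_assoc, ← abs_mul_abs_self]
  rcases eq_or_ne t 0 with rfl | h
  · simp [Real.zero_rpow hp.ne']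
  · have h0 : 0 < |t| := abs_pos.2 h
    rw [show p = (p - 2) + 1 + 1 by ring, Real.rpow_add_one h0.ne', Real.rpow_add_one h0.ne']
    ring_nf

lemma abs_spow {p : ℝ} (hp : 1 < p) (t : ℝ) : |spow p t| = |t| ^ (p - 1) := by
  rw [spow, abs_mul, abs_of_nonneg (by positivity : (0 : ℝ) ≤ |t| ^ (p - 2))]
  rcases eq_or_ne t 0 with rfl | h
  · simp [Real.zero_rpow (by linarith : p - 1 ≠ 0)]
  · rw [show p - 1 = (p - 2) + 1 by ring, Real.rpow_add_one (abs_pos.2 h).ne']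

lemma sub_mul_sub_rpow {X Y q m : ℝ} (hX : 0 ≤ X) (hY : 0 ≤ Y) (hq : 0 < q) (hm : 0 ≤ m) :
    0 ≤ (X ^ q - Y ^ q) * (X ^ m - Y ^ m) ∧
      (0 < m → (X ^ q - Y ^ q) * (X ^ m - Y ^ m) = 0 → X = Y) := by
  rcases lt_trichotomy X Y with h | rfl | h
  · have h1 := Real.rpow_lt_rpow hX h hq
    refine ⟨mul_nonneg_of_nonpos_of_nonpos (by linarith)
      (by linarith [Real.rpow_le_rpow hX h.le hm]), fun h2 h3 => ?_⟩
    have h4 := Real.rpow_lt_rpow hX h h2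
    nlinarith
  · simp
  · have h1 := Real.rpow_lt_rpow hY h hq
    refine ⟨mul_nonneg (by linarith) (by linarith [Real.rpow_le_rpow hY h.le hm]),
      fun h2 h3 => ?_⟩
    have h4 := Real.rpow_lt_rpow hY h h2
    nlinarith

/-- The discrete Díaz–Saa inequality, with the case of equality. -/
lemma discrete_diazSaa (hr : 0 < r) {p a b c d : ℝ} (hrp : r ≤ p - 1)
    (hac : Adm a c) (hbd : Adm b d) :
    0 ≤ spow p (a - b) * ((a - persp r a c) - (b - persp r b d))
        + spow p (c - d) * ((c - persp r c a) - (d - persp r d b)) ∧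
      (spow p (a - b) * ((a - persp r a c) - (b - persp r b d))
        + spow p (c - d) * ((c - persp r c a) - (d - persp r d b)) = 0 →
        a * d = b * c ∧ (r + 1 ≠ p → |a - b| = |c - d|)) := by
  have h1 := spow_mul_persp_sub_le hr (p := p) hac hbd
  have h2 := spow_mul_persp_sub_le hr (p := p) hac.symm hbd.symm
  have h3 := spow_mul_self (by linarith : 0 < p) (a - b)
  have h4 := spow_mul_self (by linarith : 0 < p) (c - d)
  have h5 := sub_mul_sub_rpow (abs_nonneg (a - b)) (abs_nonneg (c - d))
    (by linarith : 0 < r + 1) (by linarith : 0 ≤ p - (r + 1))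
  have hsplit : ∀ x : ℝ, 0 ≤ x → x ^ p = x ^ (r + 1) * x ^ (p - (r + 1)) := fun x hx => by
    rw [← Real.rpow_add_of_nonneg hx (by linarith) (by linarith)]
    congr 1; ring
  have h6 := hsplit _ (abs_nonneg (a - b))
  have h7 := hsplit _ (abs_nonneg (c - d))
  refine ⟨by nlinarith [h1.1, h2.1, h5.1], fun h => ?_⟩
  have e1 : spow p (a - b) * (persp r a c - persp r b d) =
      |c - d| ^ (r + 1) * |a - b| ^ (p - (r + 1)) := by
    refine le_antisymm h1.1 ?_
    nlinarith [h2.1, h5.1]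
  have e2 : spow p (c - d) * (persp r c a - persp r d b) =
      |a - b| ^ (r + 1) * |c - d| ^ (p - (r + 1)) := by
    refine le_antisymm h2.1 ?_
    nlinarith [h1.1, h5.1]
  refine ⟨?_, fun hne => h5.2 (lt_of_le_of_ne (by linarith) ?_) (by nlinarith)⟩
  -- The equality case of Picone is silent when its own increment vanishes; the mirrored one then
  -- decides, unless both increments vanish.
  · by_cases hab : a = b
    · by_cases hcd : c = d
      · rw [hab, hcd]
      · have := h2.2 e2 hcd
        linarith
    · exact h1.2 e1 hab
  · exact fun h0 => hne (by linarith)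

/-- Lipschitz bound for `persp` on a cone around the diagonal. -/
lemma persp_sub_le (hr : 0 < r) {M a b a' b' : ℝ} (hM : 1 ≤ M) (h : Adm a b) (h' : Adm a' b')
    (hba : b ≤ M * a) :
    persp r a b - persp r a' b' ≤ (r + 1) * M ^ (r + 1) * (|a' - a| + |b' - b|) := by
  have hpos' : (0 < a' ∧ 0 ≤ b') ∨ (a' = 0 ∧ b' = 0) := by
    rcases h' with h | h
    · exact .inl ⟨h.1, h.2.le⟩
    · exact .inr h
  obtain ⟨w, hw, hwM, hself⟩ : ∃ w, 0 < w ∧ w ≤ M ∧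
      persp r a b = (r + 1) * w ^ r * b - r * w ^ (r + 1) * a := by
    rcases h with ⟨ha, hb⟩ | ⟨rfl, rfl⟩
    · exact ⟨b / a, div_pos hb ha, (div_le_iff₀ ha).2 hba, persp_self ha hb⟩
    -- At the origin every plane touches; the slope `1` is admissible because `1 ≤ M`.
    · exact ⟨1, one_pos, hM, by simp [persp_zero hr]⟩
  have h1 := (persp_tangent hr hw hpos').1
  have hα : r * w ^ (r + 1) ≤ (r + 1) * M ^ (r + 1) := by
    have := Real.rpow_le_rpow hw.le hwM (by linarith : 0 ≤ r + 1)
    have := Real.rpow_pos_of_pos hw (r + 1)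
    nlinarith
  have hβ : (r + 1) * w ^ r ≤ (r + 1) * M ^ (r + 1) := by
    have h2 := Real.rpow_le_rpow hw.le hwM hr.le
    have h3 := Real.rpow_le_rpow_of_exponent_le hM (by linarith : r ≤ r + 1)
    nlinarith
  have hα0 : 0 ≤ r * w ^ (r + 1) := by positivity
  have hβ0 : 0 ≤ (r + 1) * w ^ r := by positivity
  calc persp r a b - persp r a' b'
      ≤ (r + 1) * w ^ r * (b - b') + r * w ^ (r + 1) * (a' - a) := by linarith
    _ ≤ (r + 1) * w ^ r * |b' - b| + r * w ^ (r + 1) * |a' - a| := by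
      gcongr
      · rw [abs_sub_comm]; exact le_abs_self _
      · exact le_abs_self _
    _ ≤ (r + 1) * M ^ (r + 1) * |b' - b| + (r + 1) * M ^ (r + 1) * |a' - a| := by gcongr
    _ = _ := by ring

/-- This Lipschitz bound yields `φ ∈ L^p`, the domination in the chain rule and the convergence of
the nonlocal integrals. -/
lemma abs_testFn_sub_le (hr : 0 < r) {M a b a' b' : ℝ} (hM : 1 ≤ M) (h : Adm a b)
    (h' : Adm a' b') (hba : b ≤ M * a) (hba' : b' ≤ M * a') :
    |(a' - persp r a' b') - (a - persp r a b)| ≤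
      (1 + (r + 1) * M ^ (r + 1)) * (|a' - a| + |b' - b|) := by
  have h1 := persp_sub_le hr hM h h' hba
  have h2 := persp_sub_le hr hM h' h hba'
  rw [abs_sub_comm a a', abs_sub_comm b b'] at h2
  have h3 := abs_le.1 (le_refl |a' - a|)
  have h4 := abs_nonneg (b' - b)
  rw [abs_le]
  constructor <;> linarith [h3.1, h3.2]

/-- On the open quadrant `a - persp r a b` is differentiable; the limit is its differential in the
direction `(α, β)` and dictates the form of `testGrad`. -/
lemma tendsto_testFn_slope {a b α β : ℝ} (ha : 0 < a) (hb : 0 < b)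
    {t A B : ℕ → ℝ} (hpos : ∀ n, 0 < t n) (ht : Tendsto t atTop (𝓝 0))
    (hA : Tendsto (fun n => (t n)⁻¹ * (A n - a)) atTop (𝓝 α))
    (hB : Tendsto (fun n => (t n)⁻¹ * (B n - b)) atTop (𝓝 β)) :
    Tendsto (fun n => (t n)⁻¹ * ((A n - persp r (A n) (B n)) - (a - persp r a b))) atTop
      (𝓝 ((1 + r * (b / a) ^ (r + 1)) * α - (r + 1) * (b / a) ^ r * β)) := by
  have h1 : HasFDerivAt (fun z : ℝ × ℝ => z.1 - persp r z.1 z.2) _ (a, b) :=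
    (hasFDerivAt_fst (𝕜 := ℝ) (E := ℝ) (F := ℝ) (p := (a, b))).sub
      (((hasFDerivAt_snd (𝕜 := ℝ) (E := ℝ) (F := ℝ) (p := (a, b))).rpow_const
        (p := r + 1) (.inl hb.ne')).mul
      ((hasFDerivAt_fst (𝕜 := ℝ) (E := ℝ) (F := ℝ) (p := (a, b))).rpow_const
        (p := -r) (.inl ha.ne')))
  have hd : ∀ {A : ℕ → ℝ} {a α : ℝ}, Tendsto (fun n => (t n)⁻¹ * (A n - a)) atTop (𝓝 α) →
      Tendsto (fun n => A n - a) atTop (𝓝 0) := fun {A a α} h => by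
    have h2 := ht.mul h
    rw [zero_mul] at h2
    refine h2.congr fun n => ?_
    rw [mul_inv_cancel_left₀ (hpos n).ne']
  have h2 := h1.hasFDerivWithinAt (s := univ) |>.lim (l := atTop)
    (c := fun n => (t n)⁻¹) (d := fun n => (A n - a, B n - b)) (v := (α, β))
    (by simpa using! (hd hA).prodMk_nhds (hd hB)) (Eventually.of_forall fun _ => mem_univ _)
    (by simpa using hA.prodMk_nhds hB)
  have e : (1 + r * (b / a) ^ (r + 1)) * α - (r + 1) * (b / a) ^ r * β =
      α - (b ^ (r + 1) * (-r * a ^ (-r - 1) * α) + a ^ (-r) * ((r + 1) * b ^ r * β)) := by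
    rw [Real.div_rpow hb.le ha.le, Real.div_rpow hb.le ha.le, Real.rpow_neg ha.le,
      show -r - 1 = -(r + 1) by ring, Real.rpow_neg ha.le]
    field_simp
    ring
  rw [e]
  simpa using h2

/-! ### The test function in `W^{1,p}` and rigidity of indicators. -/

section Sobolev

variable {N : ℕ} {p : ℝ} {u v : E N → ℝ} {g g' : E N → E N}

lemma IsWeakGrad.hasWeakDeriv (h : IsWeakGrad u g) (e : E N) :
    HasWeakDeriv volume u (fun x => inner ℝ (g x) e) e :=
  fun η hη hc => h.2.2 η hη hc e

/-- Makes the choice in `weakGrad` immaterial up to null sets. -/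
lemma IsWeakGrad.ae_eq (h : IsWeakGrad u g) (h' : IsWeakGrad u g') : g =ᵐ[volume] g' := by
  refine ae_eq_of_integral_contDiff_smul_eq h.2.1 h'.2.1 fun η hη hc => ?_
  have hi := h.2.1.integrable_smul_left_of_hasCompactSupport hη.continuous hc
  have hi' := h'.2.1.integrable_smul_left_of_hasCompactSupport hη.continuous hc
  refine ext_inner_left ℝ fun e => ?_
  rw [← integral_inner hi, ← integral_inner hi']
  have h1 := (h.2.2 η hη hc e).symm.trans (h'.2.2 η hη hc e)
  simpa [inner_smul_right, real_inner_comm, mul_comm] using neg_injective h1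

lemma IsWeakGrad.isWeakGrad_weakGrad (h : IsWeakGrad u g) : IsWeakGrad u (weakGrad u) := by
  have h1 : ∃ g, IsWeakGrad u g := ⟨g, h⟩
  rw [weakGrad, dif_pos h1]
  exact h1.choose_spec

lemma MemW1p.isWeakGrad (hu : MemW1p p u) : IsWeakGrad u (weakGrad u) :=
  hu.2.choose_spec.1.isWeakGrad_weakGrad

lemma MemW1p.memLp_weakGrad (hu : MemW1p p u) :
    MemLp (weakGrad u) (ENNReal.ofReal p) volume := by
  obtain ⟨g, hg, hgp⟩ := hu.2
  exact hgp.ae_eq (hg.ae_eq hg.isWeakGrad_weakGrad)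

lemma MemW1p.memLp_inner_weakGrad (hu : MemW1p p u) (e : E N) :
    MemLp (fun x => inner ℝ (weakGrad u x) e) (ENNReal.ofReal p) volume :=
  hu.memLp_weakGrad.inner_const e

lemma one_le_ofReal_of_one_lt (hp : 1 < p) : 1 ≤ ENNReal.ofReal p := by
  simpa using ENNReal.ofReal_le_ofReal hp.le

lemma IsWeakGrad.neg (h : IsWeakGrad u g) : IsWeakGrad (-u) (-g) := by
  refine ⟨h.1.neg, h.2.1.neg, fun η hη hc e => ?_⟩
  simp only [Pi.neg_apply, neg_mul, inner_neg_left, integral_neg, h.2.2 η hη hc e]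

/-- The weak gradient vanishes a.e. where the function attains its minimum. -/
lemma IsWeakGrad.eq_zero_of_eq_min (hp : 1 < p) (h : IsWeakGrad u g)
    (hu : MemLp u (ENNReal.ofReal p)) (hg : MemLp g (ENNReal.ofReal p)) {c : ℝ}
    (h0 : ∀ᵐ x, c ≤ u x) : ∀ᵐ x, u x = c → g x = 0 := by
  have : Fact (1 ≤ ENNReal.ofReal p) := ⟨one_le_ofReal_of_one_lt hp⟩
  have h : ∀ e : E N, ∀ᵐ x, u x = c → 0 ≤ inner ℝ (g x) e := fun e =>
    (h.hasWeakDeriv e).nonneg_of_eq_min ENNReal.ofReal_ne_top hu (hg.inner_const e) h0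
  filter_upwards [ae_all_iff.2 fun i => h (EuclideanSpace.single i 1),
    ae_all_iff.2 fun i => h (-EuclideanSpace.single i 1)] with x h1 h2 hx
  ext i
  have h3 := h1 i hx
  have h4 := h2 i hx
  simp only [inner_neg_right, EuclideanSpace.inner_single_right] at h3 h4
  simp at h3 h4
  simpa using le_antisymm h4 h3

/-- Data of a pair of functions that the test functions are built from. -/
structure IsPair (M : ℝ) (Ω : Set (E N)) (u v : E N → ℝ) : Prop where
  one_le : 1 ≤ M
  pos : ∀ᵐ x, x ∈ Ω → 0 < u x ∧ 0 < v x
  zero : ∀ᵐ x, x ∉ Ω → u x = 0 ∧ v x = 0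
  bound : ∀ᵐ x, v x ≤ M * u x ∧ u x ≤ M * v x

variable {M r : ℝ} {Ω : Set (E N)}

lemma IsPair.symm (h : IsPair M Ω u v) : IsPair M Ω v u where
  one_le := h.one_le
  pos := h.pos.mono fun _ hx h' => (hx h').symm
  zero := h.zero.mono fun _ hx h' => (hx h').symm
  bound := h.bound.mono fun _ hx => hx.symm

lemma IsPair.adm (h : IsPair M Ω u v) : ∀ᵐ x, Adm (u x) (v x) := by
  filter_upwards [h.pos, h.zero] with x h1 h2
  by_cases hx : x ∈ Ω
  · exact .inl (h1 hx)
  · exact .inr (h2 hx)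

lemma exists_isPair (hΩ : MeasurableSet Ω) (hu : MemW01p p Ω u) (hv : MemW01p p Ω v)
    (hu_pos : ∀ᵐ x ∂(volume.restrict Ω), 0 < u x) (hv_pos : ∀ᵐ x ∂(volume.restrict Ω), 0 < v x)
    (huv : MemLp (fun x => u x / v x) ∞ (volume.restrict Ω))
    (hvu : MemLp (fun x => v x / u x) ∞ (volume.restrict Ω)) :
    ∃ M, IsPair M Ω u v := by
  have hb : ∀ {f : E N → ℝ}, MemLp f ∞ (volume.restrict Ω) →
      ∃ C : ℝ, ∀ᵐ x ∂(volume.restrict Ω), f x ≤ C := fun {f} hf => by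
    refine ⟨(eLpNorm f ∞ (volume.restrict Ω)).toReal, ?_⟩
    have h2 : eLpNormEssSup f (volume.restrict Ω) ≠ ∞ := by
      simpa using hf.2.ne
    filter_upwards [ae_le_eLpNormEssSup (f := f) (μ := volume.restrict Ω)] with x hx
    rw [eLpNorm_exponent_top]
    have := ENNReal.toReal_mono h2 hx
    simp only [toReal_enorm] at this
    exact (le_abs_self _).trans this
  obtain ⟨C₁, h1⟩ := hb huv
  obtain ⟨C₂, h2⟩ := hb hvu
  have hu0 := hu.2
  have hv0 := hv.2
  rw [ae_restrict_iff' hΩ] at h1 h2 hu_pos hv_pos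
  rw [ae_restrict_iff' hΩ.compl] at hu0 hv0
  refine ⟨max 1 (max C₁ C₂), le_max_left _ _, ?_, ?_, ?_⟩
  · filter_upwards [hu_pos, hv_pos] with x h3 h4 hx using ⟨h3 hx, h4 hx⟩
  · filter_upwards [hu0, hv0] with x h3 h4 hx using ⟨h3 hx, h4 hx⟩
  · filter_upwards [h1, h2, hu_pos, hv_pos, hu0, hv0] with x h1 h2 h3 h4 h5 h6
    by_cases hx : x ∈ Ω
    · have h1 := (div_le_iff₀ (h4 hx)).1 (h1 hx)
      have h2 := (div_le_iff₀ (h3 hx)).1 (h2 hx)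
      constructor
      · refine h2.trans (mul_le_mul_of_nonneg_right ?_ (h3 hx).le)
        exact (le_max_right _ _).trans (le_max_right _ _)
      · refine h1.trans (mul_le_mul_of_nonneg_right ?_ (h4 hx).le)
        exact (le_max_left _ _).trans (le_max_right _ _)
    · simp [h5 hx, h6 hx]

/-- The gradient of the test function. -/
noncomputable def testGrad (r : ℝ) (u v : E N → ℝ) (x : E N) : E N :=
  (1 + r * (v x / u x) ^ (r + 1)) • weakGrad u x - ((r + 1) * (v x / u x) ^ r) • weakGrad v x

lemma IsPair.testFn_eq (hr : 0 < r) (h : IsPair M Ω u v) :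
    ∀ᵐ x, testFn r u v x = u x - persp r (u x) (v x) := by
  filter_upwards [h.adm] with x hx using hx.testFn_eq hr

lemma IsPair.abs_testFn_translate_sub_le (hr : 0 < r) (h : IsPair M Ω u v) (a : E N) : ∀ᵐ x,
    |testFn r u v (a + x) - testFn r u v x| ≤
      (1 + (r + 1) * M ^ (r + 1)) * (|u (a + x) - u x| + |v (a + x) - v x|) := by
  filter_upwards [h.adm, h.bound, h.testFn_eq hr, ae_translate h.adm a, ae_translate h.bound a,
    ae_translate (h.testFn_eq hr) a] with x h1 h2 h3 h4 h5 h6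
  rw [h3, h6]
  exact MixedDiazSaa.abs_testFn_sub_le hr h.one_le h1 h4 h2.1 h5.1

lemma IsPair.coeff_nonneg (hr : 0 < r) (h : IsPair M Ω u v) : 0 ≤ (r + 1) * M ^ (r + 1) := by
  have := h.one_le
  positivity

lemma aemeasurable_testFn (hu : AEMeasurable u) (hv : AEMeasurable v) :
    AEMeasurable (testFn r u v) :=
  ((hu.pow_const _).sub (hv.pow_const _)).div (hu.pow_const _)

lemma IsPair.memLp_testFn (hr : 0 < r) (h : IsPair M Ω u v)
    (hu : MemLp u (ENNReal.ofReal p)) (hv : MemLp v (ENNReal.ofReal p)) :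
    MemLp (testFn r u v) (ENNReal.ofReal p) := by
  refine ((hu.norm.add hv.norm).const_mul (1 + (r + 1) * M ^ (r + 1))).of_le_mul (c := 1)
    (aemeasurable_testFn hu.1.aemeasurable hv.1.aemeasurable).aestronglyMeasurable ?_
  filter_upwards [h.adm, h.bound, h.testFn_eq hr] with x h1 h2 h3
  have h4 := MixedDiazSaa.abs_testFn_sub_le hr h.one_le (.inr ⟨rfl, rfl⟩) h1 (by simp) h2.1
  rw [persp_zero hr] at h4
  have := h.coeff_nonneg hr
  rw [h3]
  simp only [Pi.add_apply, Real.norm_eq_abs, one_mul]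
  simp only [sub_zero] at h4
  exact h4.trans (le_abs_self _)

/-- The coefficients of the gradient are bounded in `Ω`. -/
lemma IsPair.coeff_le (hr : 0 < r) (h : IsPair M Ω u v) : ∀ᵐ x, x ∈ Ω →
    |1 + r * (v x / u x) ^ (r + 1)| ≤ 1 + (r + 1) * M ^ (r + 1) ∧
      |(r + 1) * (v x / u x) ^ r| ≤ 1 + (r + 1) * M ^ (r + 1) := by
  filter_upwards [h.pos, h.bound] with x h1 h2 hx
  obtain ⟨hu, hv⟩ := h1 hx
  have hw : 0 < v x / u x := div_pos hv hu
  have hwM : v x / u x ≤ M := (div_le_iff₀ hu).2 h2.1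
  have h3 := Real.rpow_le_rpow hw.le hwM (by linarith : 0 ≤ r + 1)
  have h4 := Real.rpow_le_rpow hw.le hwM hr.le
  have h5 := Real.rpow_le_rpow_of_exponent_le h.one_le (by linarith : r ≤ r + 1)
  have h6 := Real.rpow_pos_of_pos hw (r + 1)
  rw [abs_of_nonneg (by positivity), abs_of_nonneg (by positivity)]
  constructor <;> nlinarith

lemma IsPair.memLp_testGrad (hΩ : MeasurableSet Ω) (hr : 0 < r) (h : IsPair M Ω u v)
    (hu : MemW1p p u) (hv : MemW1p p v) :
    MemLp (Ω.indicator (testGrad r u v)) (ENNReal.ofReal p) := by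
  have hum := hu.1.1.aemeasurable
  have hvm := hv.1.1.aemeasurable
  have hm : AEStronglyMeasurable (testGrad r u v) :=
    ((((hvm.div hum).pow_const _).const_mul r).const_add
      1).aestronglyMeasurable.smul hu.memLp_weakGrad.1 |>.sub
    ((((hvm.div hum).pow_const _).const_mul (r + 1)).aestronglyMeasurable.smul
      hv.memLp_weakGrad.1)
  refine (hu.memLp_weakGrad.norm.add hv.memLp_weakGrad.norm).of_le_mul
    (c := 1 + (r + 1) * M ^ (r + 1)) (hm.indicator hΩ) ?_
  filter_upwards [h.coeff_le hr] with x hx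
  have h0 := h.coeff_nonneg hr
  by_cases hxΩ : x ∈ Ω
  · obtain ⟨h1, h2⟩ := hx hxΩ
    rw [indicator_of_mem hxΩ, testGrad]
    refine (norm_sub_le _ _).trans ?_
    simp only [norm_smul, Pi.add_apply, Real.norm_eq_abs]
    rw [abs_of_nonneg (add_nonneg (norm_nonneg (weakGrad u x)) (norm_nonneg _)), mul_add]
    gcongr
  · rw [indicator_of_notMem hxΩ, norm_zero]
    positivity

/-- In `Ω` the quotients converge by differentiability of `persp`. Outside, `u = v = 0` is the
minimum of both functions, so their gradients vanish a.e. and the Lipschitz bound squeezes the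
quotients of `φ` to zero. -/
lemma IsPair.isWeakGrad_testFn (hp : 1 < p) (hΩ : MeasurableSet Ω) (hr : 0 < r)
    (h : IsPair M Ω u v) (hu : MemW1p p u) (hv : MemW1p p v) :
    IsWeakGrad (testFn r u v) (Ω.indicator (testGrad r u v)) := by
  have : Fact (1 ≤ ENNReal.ofReal p) := ⟨one_le_ofReal_of_one_lt hp⟩
  have hφ := h.memLp_testFn hr hu.1 hv.1
  refine ⟨hφ.locallyIntegrable Fact.out,
    (h.memLp_testGrad hΩ hr hu hv).locallyIntegrable Fact.out, fun η hη hc e => ?_⟩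
  have h0 := h.coeff_nonneg hr
  have hC : 0 ≤ 1 + (r + 1) * M ^ (r + 1) := by linarith
  refine HasWeakDeriv.of_increments ENNReal.ofReal_ne_top hu.1 (hu.memLp_inner_weakGrad e)
    hv.1 (hv.memLp_inner_weakGrad e) hφ (hu.isWeakGrad.hasWeakDeriv e)
    (hv.isWeakGrad.hasWeakDeriv e) hC (h.abs_testFn_translate_sub_le hr) (fun t hpos ht => ?_) η hη hc
  have hu0 := hu.isWeakGrad.eq_zero_of_eq_min hp hu.1 hu.memLp_weakGrad (h.adm.mono fun x hx => hx.nonneg)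
  have hv0 := hv.isWeakGrad.eq_zero_of_eq_min hp hv.1 hv.memLp_weakGrad (h.adm.mono fun x hx => hx.symm.nonneg)
  filter_upwards [hu0, hv0, h.pos, h.zero, h.testFn_eq hr,
    ae_all_iff.2 fun n => ae_translate (h.testFn_eq hr) (t n • e),
    ae_all_iff.2 fun n => h.abs_testFn_translate_sub_le hr (t n • e)] with x h1 h2 h3 h4 h5 h6 h7 h8 h9
  by_cases hx : x ∈ Ω
  · simp only [h5, h6, indicator_of_mem hx, testGrad, inner_sub_left, real_inner_smul_left]
    exact tendsto_testFn_slope (h3 hx).1 (h3 hx).2 hpos ht h8 h9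
  · obtain ⟨hux, hvx⟩ := h4 hx
    rw [h1 hux, inner_zero_left] at h8
    rw [h2 hvx, inner_zero_left] at h9
    rw [indicator_of_notMem hx, inner_zero_left]
    have h10 := (h8.abs.add h9.abs).const_mul (1 + (r + 1) * M ^ (r + 1))
    simp only [abs_zero, add_zero, mul_zero] at h10
    refine squeeze_zero_norm (fun n => ?_) h10
    rw [Real.norm_eq_abs, abs_mul, abs_mul, abs_mul, ← mul_add]
    calc _ ≤ |(t n)⁻¹| * ((1 + (r + 1) * M ^ (r + 1)) *
          (|u (t n • e + x) - u x| + |v (t n • e + x) - v x|)) := by gcongr; exact h7 n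
      _ = _ := by ring

lemma IsPair.memW01p_testFn (hp : 1 < p) (hΩ : MeasurableSet Ω) (hr : 0 < r)
    (h : IsPair M Ω u v) (hu : MemW1p p u) (hv : MemW1p p v) :
    MemW01p p Ω (testFn r u v) := by
  refine ⟨⟨h.memLp_testFn hr hu.1 hv.1, _, h.isWeakGrad_testFn hp hΩ hr hu hv,
    h.memLp_testGrad hΩ hr hu hv⟩, ?_⟩
  rw [ae_restrict_iff' hΩ.compl]
  filter_upwards [h.zero] with x hx hxΩ
  simp [testFn, hx hxΩ, Real.zero_rpow (by linarith : r + 1 ≠ 0)]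

lemma IsPair.weakGrad_testFn (hp : 1 < p) (hΩ : MeasurableSet Ω) (hr : 0 < r)
    (h : IsPair M Ω u v) (hu : MemW1p p u) (hv : MemW1p p v) :
    ∀ᵐ x, x ∈ Ω → weakGrad (testFn r u v) x = testGrad r u v x := by
  have h1 := h.isWeakGrad_testFn hp hΩ hr hu hv
  filter_upwards [h1.isWeakGrad_weakGrad.ae_eq h1] with x hx hxΩ
  rw [hx, indicator_of_mem hxΩ]

/-- A constant multiple of an indicator function is in `W^{1,p}` only if it vanishes. -/
lemma MemW1p.measure_eq_zero_of_indicator (hN : 1 ≤ N) (hp : 1 < p) (hu : MemW1p p u) {a : ℝ}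
    (ha : 0 < a) (hΩ : MeasurableSet Ω) (h1 : ∀ᵐ x, x ∈ Ω → u x = a)
    (h0 : ∀ᵐ x, x ∉ Ω → u x = 0) : volume Ω = 0 := by
  have : Fact (1 ≤ ENNReal.ofReal p) := ⟨one_le_ofReal_of_one_lt hp⟩
  have hg := hu.memLp_weakGrad
  -- Off `Ω` the function `u` attains its minimum `0`, and on `Ω` the function `-u` attains its
  -- minimum `-a`.
  have hgrad : weakGrad u =ᵐ[volume] 0 := by
    filter_upwards [h0, h1, hu.isWeakGrad.eq_zero_of_eq_min hp hu.1 hg (c := 0) (by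
        filter_upwards [h0, h1] with x h2 h3
        by_cases hx : x ∈ Ω
        · rw [h3 hx]; exact ha.le
        · rw [h2 hx]), hu.isWeakGrad.neg.eq_zero_of_eq_min hp hu.1.neg hg.neg (c := -a) (by
        filter_upwards [h0, h1] with x h2 h3
        rw [Pi.neg_apply, neg_le_neg_iff]
        by_cases hx : x ∈ Ω
        · rw [h3 hx]
        · rw [h2 hx]; exact ha.le)] with x h2 h3 h4 h5
    by_cases hx : x ∈ Ω
    · simpa using h5 (by simp [h3 hx])
    · exact h4 (h2 hx)
  have hinv : ∀ h : E N, ∀ᵐ x, u (h + x) = u x := by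
    intro h
    have h2 : HasWeakDeriv volume (hu.1.toLp u) (0 : Lp ℝ (ENNReal.ofReal p) volume) h := by
      refine (hu.isWeakGrad.hasWeakDeriv h).congr hu.1.coeFn_toLp.symm ?_
      filter_upwards [hgrad, Lp.coeFn_zero ℝ (ENNReal.ofReal p) volume] with x h3 h4
      rw [h3, h4]
      simp
    have h3 := h2.norm_transl_sub_le ENNReal.ofReal_ne_top
    rw [norm_zero, norm_le_zero_iff, sub_eq_zero] at h3
    filter_upwards [coeFn_transl h (hu.1.toLp u), hu.1.coeFn_toLp,
      ae_translate hu.1.coeFn_toLp h] with x h4 h5 h6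
    rw [h3] at h4
    rw [← h5, ← h6, h4]
  have hfin : volume Ω ≠ ∞ := by
    have h2 := hu.1.meas_ge_lt_top' (ε := ENNReal.ofReal a) (by simp; linarith) (by simp)
      (by simpa using ha)
    refine ((measure_mono_ae ?_).trans_lt h2).ne
    filter_upwards [h1] with x hx hxΩ
    have h3 : u x = a := hx hxΩ
    change ENNReal.ofReal a ≤ ‖u x‖₊
    rw [h3, ← enorm_eq_nnnorm, Real.enorm_of_nonneg ha.le]
  set f : E N → ℝ≥0∞ := Ω.indicator 1 with hf
  have hfm : Measurable f := measurable_one.indicator hΩ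
  have hΩf : ∫⁻ x, f x = volume Ω := by simp [hf, hΩ]
  have h2 : ∀ h : E N, ∫⁻ x, f (h + x) * f x = volume Ω := fun h => by
    rw [← hΩf]
    refine lintegral_congr_ae ?_
    filter_upwards [hinv h, h1, h0, ae_translate h1 h, ae_translate h0 h] with x h3 h4 h5 h6 h7
    by_cases hx : x ∈ Ω
    · have : h + x ∈ Ω := by
        by_contra hc
        rw [h7 hc, h4 hx] at h3
        exact ha.ne h3
      simp [hf, hx, this]
    · simp [hf, hx]
  -- By translation invariance each overlap of `Ω` with a translate has full measure `|Ω|`.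
  -- Integrating over all shifts gives `|Ω| · ∞`, whereas Tonelli gives the finite value `|Ω|²`.
  have h3 : ∫⁻ h : E N, ∫⁻ x, f (h + x) * f x = volume Ω * volume Ω := by
    rw [lintegral_lintegral_swap (by
      exact ((hfm.comp (measurable_fst.add measurable_snd)).mul
        (hfm.comp measurable_snd)).aemeasurable)]
    have h4 : ∀ x : E N, ∫⁻ h : E N, f (h + x) * f x = volume Ω * f x := fun x => by
      have hm : Measurable fun h : E N => f (h + x) := hfm.comp (measurable_id.add_const x)
      rw [lintegral_mul_const _ hm, lintegral_add_right_eq_self f, hΩf]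
    simp only [h4]
    rw [lintegral_const_mul _ hfm, hΩf]
  simp only [h2, lintegral_const] at h3
  have : Nonempty (Fin N) := ⟨⟨0, hN⟩⟩
  have : NoncompactSpace (E N) := NormedSpace.noncompactSpace ℝ (E N)
  rw [measure_univ_of_isAddLeftInvariant] at h3
  by_contra hne
  rw [ENNReal.mul_top hne] at h3
  exact ENNReal.mul_ne_top hfin hfin h3.symm

end Sobolev

/-! ### The Gagliardo seminorm and the nonlocal term. -/

section Nonlocal

variable {N : ℕ} {p r s κ Λ M : ℝ} {u v : E N → ℝ} {Ω ω : Set (E N)} {K : E N → E N → ℝ}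

/-- In polar coordinates the integrand is `y^(p-sp-1)` near zero, integrable since `s < 1`, and
`y^(-1-sp)` at infinity, integrable since `s > 0`. -/
lemma integrable_min_rpow_div (hN : 1 ≤ N) (hp : 1 < p) (hs : s ∈ Ioo (0 : ℝ) 1) :
    Integrable fun h : E N => min ‖h‖ 1 ^ p / ‖h‖ ^ ((N : ℝ) + s * p) := by
  have : Nonempty (Fin N) := ⟨⟨0, hN⟩⟩
  have hsp : 0 < s * p := mul_pos hs.1 (by linarith)
  have hsp' : s * p < p := by nlinarith [hs.2]
  rw [integrable_fun_norm_addHaar volume (f := fun y : ℝ => min y 1 ^ p / y ^ ((N : ℝ) + s * p))]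
  simp only [finrank_euclideanSpace, Fintype.card_fin, smul_eq_mul]
  have hpow : ∀ y : ℝ, 0 < y → y ^ (N - 1) = y ^ ((N : ℝ) - 1) := fun y hy => by
    rw [← Real.rpow_natCast, Nat.cast_sub hN, Nat.cast_one]
  rw [← Ioc_union_Ioi_eq_Ioi zero_le_one, integrableOn_union]
  constructor
  · have h1 := (intervalIntegral.intervalIntegrable_rpow' (a := 0) (b := 1)
      (by linarith : -1 < p - s * p - 1)).1
    refine h1.congr_fun (fun y hy => ?_) measurableSet_Ioc
    simp only
    rw [hpow y hy.1, min_eq_left hy.2, mul_div_assoc', ← Real.rpow_add hy.1,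
      ← Real.rpow_sub hy.1]
    ring_nf
  · have h1 := integrableOn_Ioi_rpow_of_lt (by linarith : -1 - s * p < -1) one_pos
    refine h1.congr_fun (fun y (hy : 1 < y) => ?_) measurableSet_Ioi
    have hy0 : 0 < y := by linarith
    simp only
    rw [hpow y hy0, min_eq_right hy.le, Real.one_rpow, mul_div_assoc', mul_one,
      ← Real.rpow_sub hy0]
    ring_nf

/-- The factor `‖h‖` comes from the translation estimate, the factor `1` from the triangle
inequality. -/
lemma MemW1p.exists_lintegral_translate_le (hp : 1 < p) (hu : MemW1p p u) :
    ∃ B : ℝ, 0 ≤ B ∧ ∀ h : E N, ∫⁻ x, ENNReal.ofReal (|u (h + x) - u x| ^ p) ≤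
      ENNReal.ofReal (B * min ‖h‖ 1 ^ p) := by
  have : Fact (1 ≤ ENNReal.ofReal p) := ⟨one_le_ofReal_of_one_lt hp⟩
  have hp0 : 0 < p := by linarith
  set U := hu.1.toLp u with hU
  set G := hu.memLp_weakGrad.toLp (weakGrad u) with hG
  set B := max ‖G‖ (2 * ‖U‖) with hB
  have hB0 : 0 ≤ B := (norm_nonneg G).trans (le_max_left _ _)
  refine ⟨B ^ p, by positivity, fun h => ?_⟩
  have h1 : ‖transl (ENNReal.ofReal p) volume h U - U‖ ≤ B * min ‖h‖ 1 := by
    rw [mul_min_of_nonneg _ _ hB0]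
    refine le_min ?_ ?_
    · have hd : HasWeakDeriv volume U ((hu.memLp_inner_weakGrad h).toLp _) h :=
        (hu.isWeakGrad.hasWeakDeriv h).congr hu.1.coeFn_toLp.symm
          (hu.memLp_inner_weakGrad h).coeFn_toLp.symm
      refine (hd.norm_transl_sub_le ENNReal.ofReal_ne_top).trans ?_
      have h2 : ‖(hu.memLp_inner_weakGrad h).toLp _‖ ≤ ‖h‖ * ‖G‖ := by
        refine Lp.norm_le_mul_norm_of_ae_le_mul ?_
        filter_upwards [(hu.memLp_inner_weakGrad h).coeFn_toLp,
          hu.memLp_weakGrad.coeFn_toLp] with x h3 h4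
        rw [h3, hG, h4, mul_comm]
        exact norm_inner_le_norm _ _
      refine h2.trans ?_
      rw [mul_comm]
      gcongr
      exact le_max_left _ _
    · refine (norm_sub_le _ _).trans ?_
      rw [LinearIsometry.norm_map, mul_one, ← two_mul]
      exact le_max_right _ _
  have h2 : ∫⁻ x, ENNReal.ofReal (|u (h + x) - u x| ^ p) =
      ENNReal.ofReal (‖transl (ENNReal.ofReal p) volume h U - U‖ ^ p) := by
    rw [← ENNReal.ofReal_rpow_of_nonneg (norm_nonneg _) hp0.le, ofReal_norm, Lp.enorm_def,
      eLpNorm_eq_lintegral_rpow_enorm_toReal (by simpa using hp0) ENNReal.ofReal_ne_top,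
      ENNReal.toReal_ofReal hp0.le, one_div, ENNReal.rpow_inv_rpow hp0.ne']
    refine lintegral_congr_ae ?_
    filter_upwards [coeFn_transl h U, hu.1.coeFn_toLp, ae_translate hu.1.coeFn_toLp h,
      Lp.coeFn_sub (transl (ENNReal.ofReal p) volume h U) U] with x h3 h4 h5 h6
    rw [h6, Pi.sub_apply, h3, h4, h5, ← ENNReal.ofReal_rpow_of_nonneg (abs_nonneg _) hp0.le,
      ← Real.norm_eq_abs, ofReal_norm]
  rw [h2, ← Real.mul_rpow hB0 (by positivity)]
  gcongr

/-- Functions in `W^{1,p}` have finite Gagliardo seminorm. -/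
lemma MemW1p.integrable_gagliardo (hN : 1 ≤ N) (hp : 1 < p) (hs : s ∈ Ioo (0 : ℝ) 1)
    (hu : MemW1p p u) :
    Integrable (fun z : E N × E N => |u z.1 - u z.2| ^ p / ‖z.1 - z.2‖ ^ ((N : ℝ) + s * p))
      (volume.prod volume) := by
  obtain ⟨B, hB0, hB⟩ := hu.exists_lintegral_translate_le hp
  set f : E N × E N → ℝ := fun z => |u z.1 - u z.2| ^ p / ‖z.1 - z.2‖ ^ ((N : ℝ) + s * p)
    with hf
  have hum := hu.1.1.aemeasurable
  have hfm : AEMeasurable f (volume.prod volume) := by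
    have h1 : AEMeasurable (fun z : E N × E N => u z.1) (volume.prod volume) :=
      hum.comp_quasiMeasurePreserving Measure.quasiMeasurePreserving_fst
    have h2 : AEMeasurable (fun z : E N × E N => u z.2) (volume.prod volume) :=
      hum.comp_quasiMeasurePreserving Measure.quasiMeasurePreserving_snd
    have h3 : Measurable fun z : E N × E N => ‖z.1 - z.2‖ ^ ((N : ℝ) + s * p) := by fun_prop
    exact ((h1.sub h2).abs.pow_const p).div h3.aemeasurable
  have hT := measurePreserving_prod_add (volume : Measure (E N)) (volume : Measure (E N))
  have hf0 : ∀ z, 0 ≤ f z := fun z => by positivity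
  refine ⟨hfm.aestronglyMeasurable, ?_⟩
  rw [hasFiniteIntegral_iff_ofReal (Eventually.of_forall hf0)]
  have hfm' : AEMeasurable (fun z => ENNReal.ofReal (f z)) (volume.prod volume) :=
    hfm.ennreal_ofReal
  have hcomp : AEMeasurable (fun z : E N × E N => ENNReal.ofReal (f (z.1, z.1 + z.2)))
      (volume.prod volume) := hfm'.comp_quasiMeasurePreserving hT.quasiMeasurePreserving
  have h1 : ∫⁻ z, ENNReal.ofReal (f z) ∂(volume.prod volume) =
      ∫⁻ h : E N, ∫⁻ x : E N, ENNReal.ofReal (f (x, x + h)) := by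
    rw [← lintegral_prod_symm _ hcomp]
    conv_lhs => rw [← hT.map_eq]
    rw [lintegral_map' (by rw [hT.map_eq]; exact hfm') hT.aemeasurable]
  rw [h1]
  have h2 : ∀ h : E N, ∫⁻ x : E N, ENNReal.ofReal (f (x, x + h)) ≤
      ENNReal.ofReal (B * (min ‖h‖ 1 ^ p / ‖h‖ ^ ((N : ℝ) + s * p))) := by
    intro h
    have h3 : ∀ x : E N, ENNReal.ofReal (f (x, x + h)) =
        ENNReal.ofReal (|u (h + x) - u x| ^ p) *
          ENNReal.ofReal ((‖h‖ ^ ((N : ℝ) + s * p))⁻¹) := fun x => by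
      rw [← ENNReal.ofReal_mul (by positivity), hf]
      simp only [sub_add_cancel_left, norm_neg]
      rw [abs_sub_comm, add_comm x h, div_eq_mul_inv]
    simp only [h3]
    rw [lintegral_mul_const' _ _ ENNReal.ofReal_ne_top, mul_div_assoc', div_eq_mul_inv,
      ENNReal.ofReal_mul (by positivity)]
    gcongr
    exact hB h
  refine (lintegral_mono h2).trans_lt ?_
  have h3 := ((integrable_min_rpow_div hN hp hs).const_mul B)
  rw [← hasFiniteIntegral_iff_ofReal (Eventually.of_forall fun h => by positivity)]
  exact h3.2

lemma pairMeasure_le : pairMeasure ω ≤ (volume : Measure (E N)).prod volume := by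
  rw [pairMeasure, Measure.prod_restrict]
  exact Measure.restrict_le_self

lemma ae_pairMeasure {q : E N → Prop} (h : ∀ᵐ x, q x) :
    ∀ᵐ z ∂(pairMeasure ω), q z.1 ∧ q z.2 := by
  refine ae_mono pairMeasure_le ?_
  filter_upwards [Measure.quasiMeasurePreserving_fst.ae h,
    Measure.quasiMeasurePreserving_snd.ae h] with z h1 h2 using ⟨h1, h2⟩

lemma IsKernel.nonneg (hK : IsKernel p s κ Λ ω K) (hκ : 0 < κ) (hΛ : 0 < Λ) :
    ∀ᵐ z ∂(pairMeasure ω), 0 ≤ K z.1 z.2 := by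
  filter_upwards [hK.lower] with z hz
  exact (by positivity : 0 ≤ κ / (Λ * ‖z.1 - z.2‖ ^ ((N : ℝ) + s * p))).trans hz

lemma aemeasurable_fst_snd (hu : AEMeasurable u) :
    AEMeasurable (fun z : E N × E N => u z.1) (pairMeasure ω) ∧
      AEMeasurable (fun z : E N × E N => u z.2) (pairMeasure ω) :=
  ⟨(hu.comp_quasiMeasurePreserving Measure.quasiMeasurePreserving_fst).mono_measure
    pairMeasure_le, (hu.comp_quasiMeasurePreserving
      Measure.quasiMeasurePreserving_snd).mono_measure pairMeasure_le⟩

lemma MemW1p.integrable_kernel_mul (hN : 1 ≤ N) (hp : 1 < p) (hs : s ∈ Ioo (0 : ℝ) 1)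
    (hκ : 0 < κ) (hΛ : 0 < Λ) (hK : IsKernel p s κ Λ ω K) (hu : MemW1p p u) :
    Integrable (fun z : E N × E N => K z.1 z.2 * |u z.1 - u z.2| ^ p) (pairMeasure ω) := by
  have h1 := ((hu.integrable_gagliardo hN hp hs).mono_measure
    (pairMeasure_le (ω := ω))).const_mul (κ * Λ)
  have hm := aemeasurable_fst_snd (ω := ω) hu.1.1.aemeasurable
  refine h1.mono' (hK.measurable.mul ((hm.1.sub hm.2).abs.pow_const p)).aestronglyMeasurable ?_
  filter_upwards [hK.upper, hK.nonneg hκ hΛ] with z h2 h3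
  rw [Real.norm_of_nonneg (by positivity)]
  calc _ ≤ κ * Λ / ‖z.1 - z.2‖ ^ ((N : ℝ) + s * p) * |u z.1 - u z.2| ^ p := by gcongr
    _ = _ := by ring

lemma rpow_sub_one_mul_le (hp : 1 < p) {X Y : ℝ} (hX : 0 ≤ X) (hY : 0 ≤ Y) :
    X ^ (p - 1) * Y ≤ X ^ p + Y ^ p := by
  have h : ∀ Z : ℝ, 0 ≤ Z → Z ^ (p - 1) * Z = Z ^ p := fun Z hZ => by
    rw [← Real.rpow_add_one' hZ (by linarith), sub_add_cancel]
  rcases le_total X Y with h1 | h1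
  · calc _ ≤ Y ^ (p - 1) * Y := by
          gcongr
      _ = Y ^ p := h Y hY
      _ ≤ _ := by
          have : 0 ≤ X ^ p := by positivity
          linarith
  · calc _ ≤ X ^ (p - 1) * X := by gcongr
      _ = X ^ p := h X hX
      _ ≤ _ := by
          have : 0 ≤ Y ^ p := by positivity
          linarith

lemma IsPair.integrable_nonlocalDensity (hN : 1 ≤ N) (hp : 1 < p) (hs : s ∈ Ioo (0 : ℝ) 1)
    (hκ : 0 < κ) (hΛ : 0 < Λ) (hr : 0 < r) (hK : IsKernel p s κ Λ ω K) (h : IsPair M Ω u v)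
    (hu : MemW1p p u) (hv : MemW1p p v) :
    Integrable (nonlocalDensity p K u (testFn r u v)) (pairMeasure ω) := by
  have h1 := hu.integrable_kernel_mul hN hp hs hκ hΛ hK
  have h2 := hv.integrable_kernel_mul hN hp hs hκ hΛ hK
  set C := 1 + (r + 1) * M ^ (r + 1) with hC
  have hC0 : 0 ≤ C := by linarith [h.coeff_nonneg hr]
  have hum := aemeasurable_fst_snd (ω := ω) hu.1.1.aemeasurable
  have hφm := aemeasurable_fst_snd (ω := ω)
    (aemeasurable_testFn (r := r) hu.1.1.aemeasurable hv.1.1.aemeasurable)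
  have hspow : Measurable (spow p) := by
    unfold spow
    fun_prop
  refine (((h1.add h1).add h2).const_mul C).mono' ((hK.measurable.mul
    (hspow.comp_aemeasurable (hum.1.sub hum.2))).mul (hφm.1.sub hφm.2)).aestronglyMeasurable ?_
  filter_upwards [hK.nonneg hκ hΛ, ae_pairMeasure h.adm, ae_pairMeasure h.bound,
    ae_pairMeasure (h.testFn_eq hr)] with z h3 h4 h5 h6
  have h7 := abs_testFn_sub_le hr h.one_le h4.2 h4.1 h5.2.1 h5.1.1
  rw [← h6.1, ← h6.2] at h7
  rw [nonlocalDensity, Real.norm_eq_abs, abs_mul, abs_mul, abs_of_nonneg h3, abs_spow hp]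
  set X := |u z.1 - u z.2|
  set Y := |v z.1 - v z.2|
  have hX : 0 ≤ X := abs_nonneg _
  have hY : 0 ≤ Y := abs_nonneg _
  have h8 := rpow_sub_one_mul_le hp hX hY
  have h9 : X ^ (p - 1) * X = X ^ p := by
    rw [← Real.rpow_add_one' hX (by linarith), sub_add_cancel]
  calc K z.1 z.2 * X ^ (p - 1) * |testFn r u v z.1 - testFn r u v z.2|
      ≤ K z.1 z.2 * X ^ (p - 1) * (C * (X + Y)) := by gcongr
    _ = C * (K z.1 z.2 * (X ^ (p - 1) * X + X ^ (p - 1) * Y)) := by ring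
    _ ≤ C * (K z.1 z.2 * (X ^ p + (X ^ p + Y ^ p))) := by
        rw [h9]
        gcongr
    _ = _ := by simp only [Pi.add_apply]; ring

/-- The pointwise nonlocal inequality, with the case of equality. -/
lemma IsPair.nonlocalDensity_add (hκ : 0 < κ) (hΛ : 0 < Λ) (hr : 0 < r) (hrp : r ≤ p - 1)
    (hK : IsKernel p s κ Λ ω K) (h : IsPair M Ω u v) :
    ∀ᵐ z ∂(pairMeasure ω),
      0 ≤ nonlocalDensity p K u (testFn r u v) z + nonlocalDensity p K v (testFn r v u) z ∧
      (nonlocalDensity p K u (testFn r u v) z + nonlocalDensity p K v (testFn r v u) z = 0 →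
        u z.1 * v z.2 = u z.2 * v z.1 ∧
          (r + 1 ≠ p → |u z.1 - u z.2| = |v z.1 - v z.2|)) := by
  filter_upwards [hK.lower, hK.nonneg hκ hΛ, ae_pairMeasure h.adm,
    ae_pairMeasure (h.testFn_eq hr), ae_pairMeasure (h.symm.testFn_eq hr)] with z h1 h2 h3 h4 h5
  have h6 := discrete_diazSaa hr hrp h3.1 h3.2
  have h7 : nonlocalDensity p K u (testFn r u v) z + nonlocalDensity p K v (testFn r v u) z =
      K z.1 z.2 * (spow p (u z.1 - u z.2) *
          ((u z.1 - persp r (u z.1) (v z.1)) - (u z.2 - persp r (u z.2) (v z.2)))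
        + spow p (v z.1 - v z.2) *
          ((v z.1 - persp r (v z.1) (u z.1)) - (v z.2 - persp r (v z.2) (u z.2)))) := by
    rw [nonlocalDensity, nonlocalDensity, h4.1, h4.2, h5.1, h5.2]
    ring
  rw [h7]
  refine ⟨mul_nonneg h2 h6.1, fun h8 => ?_⟩
  rcases mul_eq_zero.1 h8 with h9 | h9
  -- On the diagonal the lower bound for `K` reads `κ / 0 = 0` and carries no information, but there
  -- both conclusions are trivial.
  · have h10 : z.1 = z.2 := by
      by_contra hne
      have : 0 < ‖z.1 - z.2‖ := norm_pos_iff.2 (sub_ne_zero.2 hne)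
      have : 0 < κ / (Λ * ‖z.1 - z.2‖ ^ ((N : ℝ) + s * p)) := by positivity
      linarith
    simp [h10]
  · exact h6.2 h9

end Nonlocal

/-! ### Convex homogeneous densities and Picone's inequality. -/

section Local

variable {F : Type*} [NormedAddCommGroup F] [InnerProductSpace ℝ F] [CompleteSpace F]
  {p r : ℝ} {f : F → ℝ}

/-- Euler's identity: differentiate `f (t • z) = t^p f z` at `t = 1`. -/
lemma inner_gradient_self (hd : Differentiable ℝ f)
    (hom : ∀ (t : ℝ) z, f (t • z) = |t| ^ p * f z) (z : F) :
    inner ℝ (gradient f z) z = p * f z := by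
  have h1 := (hd z).hasGradientAt.hasFDerivAt
  have h2 : HasDerivAt (fun t : ℝ => t • z) z 1 := by
    simpa using (hasDerivAt_id (1 : ℝ)).smul_const z
  rw [← one_smul ℝ z] at h1
  have h3 := h1.comp_hasDerivAt (1 : ℝ) h2
  have h4 : HasDerivAt (fun t : ℝ => t ^ p * f z) (p * f z) 1 := by
    simpa using (Real.hasDerivAt_rpow_const (x := 1) (p := p) (.inl one_ne_zero)).mul_const (f z)
  have h5 : HasDerivAt (fun t : ℝ => t ^ p * f z) _ 1 := h3.congr_of_eventuallyEq (by
    filter_upwards [lt_mem_nhds (zero_lt_one (α := ℝ))] with t ht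
    simp [hom, abs_of_pos ht])
  simpa using h5.unique h4

lemma inner_gradient_sub_le (hd : Differentiable ℝ f) (hc : ConvexOn ℝ univ f) (a b : F) :
    inner ℝ (gradient f a) (b - a) ≤ f b - f a := by
  have h1 := (hd a).hasGradientAt.hasFDerivAt
  have h2 : HasDerivAt (fun t : ℝ => a + t • (b - a)) (b - a) 0 := by
    simpa using ((hasDerivAt_id (0 : ℝ)).smul_const (b - a)).const_add a
  have h3 : a = a + (0 : ℝ) • (b - a) := by simp
  rw [h3] at h1
  have h4 := h1.comp_hasDerivAt (0 : ℝ) h2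
  rw [hasDerivAt_iff_tendsto_slope_zero] at h4
  have h5 := h4.mono_left (nhdsWithin_mono (0 : ℝ) (s := Ioi 0) (fun t ht => ne_of_gt ht))
  simp only [InnerProductSpace.toDual_apply_apply, ← h3] at h5
  refine le_of_tendsto h5 ?_
  filter_upwards [Ioo_mem_nhdsGT (zero_lt_one (α := ℝ))] with t ht
  have h6 := hc.2 (mem_univ a) (mem_univ b) (sub_nonneg.2 ht.2.le) ht.1.le (by ring)
  have h7 : (1 - t) • a + t • b = a + (0 + t) • (b - a) := by
    rw [zero_add, sub_smul, one_smul, smul_sub]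
    abel
  rw [h7] at h6
  simp only [smul_eq_mul, Function.comp_apply, ← h3] at h6 ⊢
  rw [inv_mul_le_iff₀ ht.1]
  linarith

/-- The tangent inequality for `f` at `a`, with Euler's identity inserted; it plays the role of
Young's inequality. -/
lemma inner_gradient_le (hd : Differentiable ℝ f) (hc : ConvexOn ℝ univ f)
    (hom : ∀ (t : ℝ) z, f (t • z) = |t| ^ p * f z) (a b : F) :
    inner ℝ (gradient f a) b ≤ f b + (p - 1) * f a := by
  have h1 := inner_gradient_self hd hom a
  have h2 := inner_gradient_sub_le hd hc a b
  rw [inner_sub_right] at h2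
  linarith

lemma abs_inner_gradient_le (hd : Differentiable ℝ f) (hc : ConvexOn ℝ univ f)
    (hom : ∀ (t : ℝ) z, f (t • z) = |t| ^ p * f z) (a b : F) :
    |inner ℝ (gradient f a) b| ≤ f b + (p - 1) * f a := by
  have h1 := inner_gradient_le hd hc hom a b
  have h2 := inner_gradient_le hd hc hom a (-b)
  have h3 := hom (-1) b
  simp at h3
  rw [h3, inner_neg_right] at h2
  exact abs_le.2 ⟨by linarith, h1⟩

/-- Picone's inequality for a convex homogeneous function. -/
lemma picone (hp : 1 < p) (hr : 0 < r) (hrp : r ≤ p - 1) (hd : Differentiable ℝ f)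
    (hc : ConvexOn ℝ univ f) (hom : ∀ (t : ℝ) z, f (t • z) = |t| ^ p * f z) (h0 : ∀ z, 0 ≤ f z)
    (a b : F) {w : ℝ} (hw : 0 < w) :
    (r + 1) * (f a - f b) ≤ inner ℝ (gradient f a)
      ((1 + r * w ^ (r + 1)) • a - ((r + 1) * w ^ r) • b) := by
  have hp1 : 0 < p - 1 := by linarith
  have h1 := inner_gradient_self hd hom a
  -- This scaling makes `τ^(p-1) = w^r`, so that testing with `τ⁻¹ • b` leaves coefficient exactly
  -- `1` on `f b`.
  set τ := w ^ (r / (p - 1)) with hτ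
  have hτ0 : 0 < τ := Real.rpow_pos_of_pos hw _
  have hwr : 0 < w ^ r := Real.rpow_pos_of_pos hw r
  have hτp : τ ^ (p - 1) = w ^ r := by
    rw [hτ, ← Real.rpow_mul hw.le]
    field_simp
  have h2 := inner_gradient_le hd hc hom a (τ⁻¹ • b)
  rw [hom, abs_of_pos (inv_pos.2 hτ0), inner_smul_right, Real.inv_rpow hτ0.le] at h2
  have h3 : τ ^ p = w ^ r * τ := by
    rw [← hτp, ← Real.rpow_add_one hτ0.ne', sub_add_cancel]
  rw [h3] at h2
  have h4 : w ^ r * inner ℝ (gradient f a) b ≤ f b + (p - 1) * (w ^ r * τ) * f a := by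
    have h5 := mul_le_mul_of_nonneg_left h2 (mul_pos hwr hτ0).le
    have e1 : w ^ r * τ * (τ⁻¹ * inner ℝ (gradient f a) b) = w ^ r * inner ℝ (gradient f a) b := by
      field_simp
    have e2 : w ^ r * τ * ((w ^ r * τ)⁻¹ * f b + (p - 1) * f a) =
        f b + (p - 1) * (w ^ r * τ) * f a := by
      field_simp
    linarith
  have h6 : (r + 1) * (p - 1) * (w ^ r * τ) ≤ (p - (r + 1)) + p * r * w ^ (r + 1) := by
    have hden : 0 < (r + 1) * (p - 1) := by positivity
    -- The weights sum to one because `(p - r - 1) + p r = (r + 1)(p - 1)`, and the resulting power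
    -- of `w` is `r + r / (p - 1)`.
    have h7 := Real.geom_mean_le_arith_mean2_weighted (w₁ := (p - (r + 1)) / ((r + 1) * (p - 1)))
      (w₂ := p * r / ((r + 1) * (p - 1))) (p₁ := 1) (p₂ := w ^ (r + 1))
      (div_nonneg (by linarith) hden.le) (by positivity) zero_le_one (by positivity) (by
        field_simp
        ring)
    have h8 : (w ^ (r + 1)) ^ (p * r / ((r + 1) * (p - 1))) = w ^ r * τ := by
      rw [hτ, ← Real.rpow_mul hw.le, ← Real.rpow_add hw]
      congr 1
      field_simp
      ring
    rw [Real.one_rpow, one_mul, h8] at h7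
    have h9 := mul_le_mul_of_nonneg_left h7 hden.le
    have e1 : (r + 1) * (p - 1) * ((p - (r + 1)) / ((r + 1) * (p - 1)) * 1 +
        p * r / ((r + 1) * (p - 1)) * w ^ (r + 1)) = (p - (r + 1)) + p * r * w ^ (r + 1) := by
      field_simp
    linarith
  rw [inner_sub_right, inner_smul_right, inner_smul_right, h1]
  have h10 := mul_le_mul_of_nonneg_right h6 (h0 a)
  have h11 := mul_le_mul_of_nonneg_left h4 (by linarith : 0 ≤ r + 1)
  linarith

/-- Superposition of a Carathéodory function with a measurable function. -/
lemma aemeasurable_caratheodory {α G : Type*} [MeasurableSpace α] [TopologicalSpace G]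
    [TopologicalSpace.PseudoMetrizableSpace G] {μ : Measure α} {H : α → G → ℝ} {g : α → G}
    (hH : ∀ z, AEMeasurable (fun x => H x z) μ) (hc : ∀ᵐ x ∂μ, Continuous (H x))
    (hg : AEStronglyMeasurable g μ) : AEMeasurable (fun x => H x (g x)) μ := by
  borelize G
  have h1 : ∀ n, AEMeasurable (fun x => H x (hg.stronglyMeasurable_mk.approx n x)) μ := by
    intro n
    set φ := hg.stronglyMeasurable_mk.approx n
    have h2 : (fun x => H x (φ x)) =
        fun x => ∑ z ∈ φ.range, (φ ⁻¹' {z}).indicator (fun x => H x z) x := by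
      ext x
      rw [Finset.sum_eq_single_of_mem (φ x) (φ.mem_range_self x) fun z _ hz =>
      indicator_of_notMem (s := φ ⁻¹' {z}) (fun h : φ x = z => hz h.symm) _]
      simp
    rw [h2]
    exact Finset.aemeasurable_fun_sum _ fun z _ => (hH z).indicator (φ.measurableSet_fiber z)
  refine aemeasurable_of_tendsto_metrizable_ae atTop h1 ?_
  filter_upwards [hc, hg.ae_eq_mk] with x h2 h3
  rw [h3]
  exact (h2.tendsto _).comp (hg.stronglyMeasurable_mk.tendsto_approx x)

/-- The directional derivative is a limit of difference quotients of Carathéodory superpositions, so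
measurability of the gradient itself is never needed. -/
lemma aemeasurable_inner_gradient {α : Type*} [MeasurableSpace α] {μ : Measure α}
    {H : α → F → ℝ} {g k : α → F} (hH : ∀ z, AEMeasurable (fun x => H x z) μ)
    (hc : ∀ᵐ x ∂μ, Differentiable ℝ (H x)) (hg : AEStronglyMeasurable g μ)
    (hk : AEStronglyMeasurable k μ) :
    AEMeasurable (fun x => inner ℝ (gradient (H x) (g x)) (k x)) μ := by
  have hcont : ∀ᵐ x ∂μ, Continuous (H x) := hc.mono fun x hx => hx.continuous
  set t : ℕ → ℝ := fun n => 1 / ((n : ℝ) + 1) with ht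
  refine aemeasurable_of_tendsto_metrizable_ae atTop
    (f := fun n x => (t n)⁻¹ * (H x (g x + t n • k x) - H x (g x))) (fun n =>
      ((aemeasurable_caratheodory hH hcont (hg.add (hk.const_smul (t n)))).sub
        (aemeasurable_caratheodory hH hcont hg)).const_mul _) ?_
  filter_upwards [hc] with x hx
  have h1 := ((hx (g x)).hasGradientAt.hasFDerivAt.hasFDerivWithinAt (s := univ)).lim (l := atTop)
    (c := fun n => (t n)⁻¹) (d := fun n => t n • k x) (v := k x)
    (by simpa only [zero_smul] using
      (tendsto_one_div_add_atTop_nhds_zero_nat (𝕜 := ℝ)).smul_const (k x))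
    (Eventually.of_forall fun _ => mem_univ _)
    (tendsto_const_nhds.congr fun n => by
      rw [smul_smul, inv_mul_cancel₀ (by positivity), one_smul])
  simpa using h1

end Local

/-! ### Integrability and lower bound of the local term. -/

section LocalDensity

variable {N : ℕ} {p r M : ℝ} {u v : E N → ℝ} {Ω ω : Set (E N)} {H : E N → E N → ℝ}

lemma IsLocalDensity.ae_good (hH : IsLocalDensity p Ω H) (ω : Set (E N)) :
    ∀ᵐ x ∂(volume.restrict (ω ∩ Ω)), Differentiable ℝ (H x) ∧ ConvexOn ℝ univ (H x) ∧
      (∀ (t : ℝ) z, H x (t • z) = |t| ^ p * H x z) ∧ ∀ z, 0 ≤ H x z := by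
  refine ae_mono (Measure.restrict_mono inter_subset_right le_rfl) ?_
  filter_upwards [hH.contDiff, hH.nonneg, hH.convex, hH.homogeneous] with x h1 h2 h3 h4
  exact ⟨h1.differentiable one_ne_zero, h3, h4, h2⟩

lemma IsPair.integrableOn_localDensity (hp : 1 < p) (hr : 0 < r) (hΩ : MeasurableSet Ω)
    (hω : MeasurableSet ω)
    (hH : IsLocalDensity p Ω H) (h : IsPair M Ω u v) (hu : MemW1p p u) (hv : MemW1p p v)
    (hHu : IntegrableOn (fun x => H x (weakGrad u x)) (ω ∩ Ω))
    (hHv : IntegrableOn (fun x => H x (weakGrad v x)) (ω ∩ Ω)) :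
    IntegrableOn (localDensity H u (testFn r u v)) (ω ∩ Ω) := by
  have hφ := h.memW01p_testFn hp hΩ hr hu hv
  have hgood := hH.ae_good ω
  set C := 1 + (r + 1) * M ^ (r + 1) with hC
  have hC0 : 0 ≤ C := by linarith [h.coeff_nonneg hr]
  have hm : AEMeasurable (localDensity H u (testFn r u v)) (volume.restrict (ω ∩ Ω)) :=
    aemeasurable_inner_gradient
      (fun z => (hH.measurable z).mono_measure (Measure.restrict_mono inter_subset_right le_rfl))
      (hgood.mono fun x hx => hx.1) hu.memLp_weakGrad.1.restrict
      hφ.1.memLp_weakGrad.1.restrict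
  refine Integrable.mono' ((hHu.const_mul (C * p)).add
    ((hHv.add (hHu.const_mul (p - 1))).const_mul C)) hm.aestronglyMeasurable ?_
  filter_upwards [hgood, ae_restrict_of_ae (h.weakGrad_testFn hp hΩ hr hu hv),
    ae_restrict_of_ae (h.coeff_le hr), ae_restrict_mem (hω.inter hΩ)] with x h1 h2 h3 h4
  obtain ⟨hd, hc, hom, h0⟩ := h1
  obtain ⟨h5, h6⟩ := h3 h4.2
  rw [localDensity, h2 h4.2, testGrad, inner_sub_right, inner_smul_right, inner_smul_right,
    inner_gradient_self hd hom, Real.norm_eq_abs]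
  have h7 := abs_inner_gradient_le hd hc hom (weakGrad u x) (weakGrad v x)
  refine (abs_sub _ _).trans ?_
  rw [abs_mul, abs_mul, abs_mul, abs_of_nonneg (h0 _), abs_of_pos (by linarith : 0 < p)]
  simp only [Pi.add_apply]
  have h8 := h0 (weakGrad u x)
  calc _ ≤ C * (p * H x (weakGrad u x)) +
        C * (H x (weakGrad v x) + (p - 1) * H x (weakGrad u x)) := by gcongr
    _ = _ := by ring

/-- The pointwise Picone inequality for the local density. -/
lemma IsPair.le_localDensity (hp : 1 < p) (hr : 0 < r) (hrp : r ≤ p - 1) (hΩ : MeasurableSet Ω)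
    (hω : MeasurableSet ω)
    (hH : IsLocalDensity p Ω H) (h : IsPair M Ω u v) (hu : MemW1p p u) (hv : MemW1p p v) :
    ∀ᵐ x ∂(volume.restrict (ω ∩ Ω)), (r + 1) * (H x (weakGrad u x) - H x (weakGrad v x)) ≤
      localDensity H u (testFn r u v) x := by
  filter_upwards [hH.ae_good ω, ae_restrict_of_ae (h.weakGrad_testFn hp hΩ hr hu hv),
    ae_restrict_of_ae h.pos, ae_restrict_mem (hω.inter hΩ)] with x h1 h2 h3 h4
  obtain ⟨hd, hc, hom, h0⟩ := h1
  rw [localDensity, h2 h4.2, testGrad]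
  exact picone hp hr hrp hd hc hom h0 _ _ (div_pos (h3 h4.2).2 (h3 h4.2).1)

end LocalDensity

/-! ### Rigidity in the case of equality. -/

section Equality

variable {N : ℕ} {p r M : ℝ} {u v : E N → ℝ} {Ω ω : Set (E N)}

/-- Equality a.e. in the discrete inequality forces proportionality. -/
lemma IsPair.exists_div_eq (hΩ : MeasurableSet Ω) (hω : MeasurableSet ω) (h : IsPair M Ω u v)
    (hpair : ∀ᵐ z ∂(pairMeasure ω), u z.1 * v z.2 = u z.2 * v z.1) :
    ∃ c : ℝ, 0 < c ∧ ∀ᵐ x ∂(volume.restrict (ω ∩ Ω)), u x / v x = c := by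
  rcases eq_or_ne (volume.restrict (ω ∩ Ω)) 0 with h0 | h0
  · exact ⟨1, one_pos, by simp [h0]⟩
  have : (ae (volume.restrict (ω ∩ Ω))).NeBot := ae_neBot.2 h0
  have hle : volume.restrict (ω ∩ Ω) ≤ volume.restrict ω :=
    Measure.restrict_mono inter_subset_left le_rfl
  have h1 : ∀ᵐ x ∂(volume.restrict (ω ∩ Ω)), ∀ᵐ y ∂(volume.restrict (ω ∩ Ω)),
      u x * v y = u y * v x := by
    filter_upwards [ae_mono hle (Measure.ae_ae_of_ae_prod hpair)] with x hx
    exact ae_mono hle hx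
  have hpos : ∀ᵐ x ∂(volume.restrict (ω ∩ Ω)), 0 < u x ∧ 0 < v x := by
    filter_upwards [ae_restrict_of_ae h.pos, ae_restrict_mem (hω.inter hΩ)] with x h2 h3
      using h2 h3.2
  -- By Fubini a single generic point `x` is proportional to almost every `y`, and its ratio is the
  -- constant.
  obtain ⟨x, hx, hux, hvx⟩ := (h1.and hpos).exists
  refine ⟨u x / v x, div_pos hux hvx, ?_⟩
  filter_upwards [hx, hpos] with y hy hy'
  rw [div_eq_div_iff hy'.2.ne' hvx.ne']
  exact hy.symm

/-- The relation `u = c v` extends to `ω \ Ω`, where both vanish. Equal increments then give `c |v x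
- v y| = |v x - v y|`, so either `c = 1` or `v` is constant on all of `ω`. -/
lemma IsPair.eq_or_const (hΩ : MeasurableSet Ω) (hω : MeasurableSet ω) (h : IsPair M Ω u v)
    {c : ℝ} (hc : 0 < c) (hcuv : ∀ᵐ x ∂(volume.restrict (ω ∩ Ω)), u x / v x = c)
    (hpair : ∀ᵐ z ∂(pairMeasure ω), |u z.1 - u z.2| = |v z.1 - v z.2|) :
    (∀ᵐ x ∂(volume.restrict (ω ∩ Ω)), u x = v x) ∨
      ∃ a b : ℝ, ∀ᵐ x ∂(volume.restrict ω), u x = a ∧ v x = b := by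
  have hprop : ∀ᵐ x, x ∈ ω → u x = c * v x := by
    rw [ae_restrict_iff' (hω.inter hΩ)] at hcuv
    filter_upwards [hcuv, h.pos, h.zero] with x h1 h2 h3 hx
    by_cases hxΩ : x ∈ Ω
    · exact (div_eq_iff (h2 hxΩ).2.ne').1 (h1 ⟨hx, hxΩ⟩)
    · simp [h3 hxΩ]
  have hprop' : ∀ᵐ x ∂(volume.restrict ω), u x = c * v x := (ae_restrict_iff' hω).2 hprop
  by_cases hc1 : c = 1
  · left
    filter_upwards [ae_mono (Measure.restrict_mono inter_subset_left le_rfl) hprop'] with x hx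
    rw [hx, hc1, one_mul]
  right
  rcases eq_or_ne (volume.restrict ω) 0 with h0 | h0
  · exact ⟨0, 0, by simp [h0]⟩
  have : (ae (volume.restrict ω)).NeBot := ae_neBot.2 h0
  obtain ⟨x, hx, hxp⟩ := ((Measure.ae_ae_of_ae_prod hpair).and hprop').exists
  refine ⟨c * v x, v x, ?_⟩
  filter_upwards [hx, hprop'] with y h1 h2
  have h3 : v x = v y := by
    rw [hxp, h2, ← mul_sub, abs_mul, abs_of_pos hc] at h1
    by_contra hne
    have h4 : 0 < |v x - v y| := abs_pos.2 (sub_ne_zero.2 hne)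
    exact hc1 (mul_right_cancel₀ h4.ne' (h1.trans (one_mul _).symm))
  rw [h2, h3]
  exact ⟨rfl, rfl⟩

end Equality

end MixedDiazSaa

/-! ### Assembly of the local and nonlocal parts. -/

theorem mainTheorem3 (N : ℕ) (hN : 1 ≤ N) (p r s κ Λ : ℝ)
    (hp : 1 < p) (hr : 0 < r) (hrp : r ≤ p - 1) (hs : s ∈ Ioo (0 : ℝ) 1)
    (hκ : κ ∈ Ioc (0 : ℝ) 1) (hΛ : 0 < Λ)
    (Ω : Set (MixedDiazSaa.E N)) (hΩ : IsOpen Ω)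
    (ω : Set (MixedDiazSaa.E N)) (hω : MeasurableSet ω)
    (H : MixedDiazSaa.E N → MixedDiazSaa.E N → ℝ) (hH : MixedDiazSaa.IsLocalDensity p Ω H)
    (K : MixedDiazSaa.E N → MixedDiazSaa.E N → ℝ) (hK : MixedDiazSaa.IsKernel p s κ Λ ω K)
    (u v : MixedDiazSaa.E N → ℝ)
    (hu : MixedDiazSaa.MemW01p p Ω u) (hv : MixedDiazSaa.MemW01p p Ω v)
    (hu_pos : ∀ᵐ x ∂(volume.restrict Ω), 0 < u x)
    (hv_pos : ∀ᵐ x ∂(volume.restrict Ω), 0 < v x)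
    (huv : MemLp (fun x => u x / v x) ∞ (volume.restrict Ω))
    (hvu : MemLp (fun x => v x / u x) ∞ (volume.restrict Ω))
    (hHu : IntegrableOn (fun x => H x (MixedDiazSaa.weakGrad u x)) (ω ∩ Ω))
    (hHv : IntegrableOn (fun x => H x (MixedDiazSaa.weakGrad v x)) (ω ∩ Ω)) :
    -- the test functions are admissible and all the integrals converge
    (MixedDiazSaa.MemW01p p Ω (MixedDiazSaa.testFn r u v) ∧
      MixedDiazSaa.MemW01p p Ω (MixedDiazSaa.testFn r v u) ∧
      IntegrableOn (MixedDiazSaa.localDensity H u (MixedDiazSaa.testFn r u v)) (ω ∩ Ω) ∧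
      IntegrableOn (MixedDiazSaa.localDensity H v (MixedDiazSaa.testFn r v u)) (ω ∩ Ω) ∧
      Integrable (MixedDiazSaa.nonlocalDensity p K u (MixedDiazSaa.testFn r u v))
        (MixedDiazSaa.pairMeasure ω) ∧
      Integrable (MixedDiazSaa.nonlocalDensity p K v (MixedDiazSaa.testFn r v u))
        (MixedDiazSaa.pairMeasure ω)) ∧
    -- the inequality
    0 ≤ MixedDiazSaa.diazSaa p r Ω ω H K u v ∧
    -- the case of equality
    (MixedDiazSaa.diazSaa p r Ω ω H K u v = 0 →
      (∃ c : ℝ, 0 < c ∧ ∀ᵐ x ∂(volume.restrict (ω ∩ Ω)), u x / v x = c) ∧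
      (r + 1 ≠ p →
        ((∀ᵐ x ∂(volume.restrict (ω ∩ Ω)), u x = v x) ∨
          ∃ a b : ℝ, ∀ᵐ x ∂(volume.restrict ω), u x = a ∧ v x = b)) ∧
      (volume (Ω \ ω) = 0 →
        (∃ c : ℝ, 0 < c ∧ ∀ᵐ x ∂(volume.restrict Ω), u x / v x = c) ∧
        (r + 1 ≠ p → ∀ᵐ x ∂(volume.restrict Ω), u x = v x))) := by
  have hΩm := hΩ.measurableSet
  obtain ⟨M, h⟩ := MixedDiazSaa.exists_isPair hΩm hu hv hu_pos hv_pos huv hvu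
  have hI1 := h.integrableOn_localDensity hp hr hΩm hω hH hu.1 hv.1 hHu hHv
  have hI2 := h.symm.integrableOn_localDensity hp hr hΩm hω hH hv.1 hu.1 hHv hHu
  have hI3 := h.integrable_nonlocalDensity hN hp hs hκ.1 hΛ hr hK hu.1 hv.1
  have hI4 := h.symm.integrable_nonlocalDensity hN hp hs hκ.1 hΛ hr hK hv.1 hu.1
  have hloc : 0 ≤ (∫ x in ω ∩ Ω, MixedDiazSaa.localDensity H u (MixedDiazSaa.testFn r u v) x)
      + ∫ x in ω ∩ Ω, MixedDiazSaa.localDensity H v (MixedDiazSaa.testFn r v u) x := by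
    rw [← integral_add hI1 hI2]
    refine integral_nonneg_of_ae ?_
    filter_upwards [h.le_localDensity hp hr hrp hΩm hω hH hu.1 hv.1,
      h.symm.le_localDensity hp hr hrp hΩm hω hH hv.1 hu.1] with x h1 h2
    simp only [Pi.zero_apply]
    linarith
  have hadd := h.nonlocalDensity_add hκ.1 hΛ hr hrp hK
  have hnon0 := hadd.mono fun _ hz => hz.1
  have hnon := integral_nonneg_of_ae hnon0
  have hsum := integral_add hI3 hI4
  refine ⟨⟨h.memW01p_testFn hp hΩm hr hu.1 hv.1, h.symm.memW01p_testFn hp hΩm hr hv.1 hu.1,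
    hI1, hI2, hI3, hI4⟩, ?_, fun hD => ?_⟩
  · rw [MixedDiazSaa.diazSaa]
    linarith
  rw [MixedDiazSaa.diazSaa] at hD
  -- Since `hloc` and `hnon` bound both partial sums below by zero, `D = 0` forces the nonlocal one
  -- to vanish.
  have hzero := (integral_eq_zero_iff_of_nonneg_ae hnon0 (hI3.add hI4)).1 (by linarith)
  have heq : ∀ᵐ z ∂(MixedDiazSaa.pairMeasure ω), u z.1 * v z.2 = u z.2 * v z.1 ∧
      (r + 1 ≠ p → |u z.1 - u z.2| = |v z.1 - v z.2|) := by
    filter_upwards [hadd, hzero] with z h1 h2 using h1.2 h2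
  obtain ⟨c, hc, hcuv⟩ := h.exists_div_eq hΩm hω (heq.mono fun _ hz => hz.1)
  have hii : r + 1 ≠ p → ((∀ᵐ x ∂(volume.restrict (ω ∩ Ω)), u x = v x) ∨
      ∃ a b : ℝ, ∀ᵐ x ∂(volume.restrict ω), u x = a ∧ v x = b) := fun hne =>
    h.eq_or_const hΩm hω hc hcuv (heq.mono fun _ hz => hz.2 hne)
  refine ⟨⟨c, hc, hcuv⟩, hii, fun hnull => ?_⟩
  have hres : volume.restrict (ω ∩ Ω) = volume.restrict Ω := by
    refine Measure.restrict_congr_set (inter_comm ω Ω ▸ ?_)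
    exact (ae_eq_set ).2 ⟨by simp [inter_sdiff_assoc], by simpa using hnull⟩
  rw [hres] at hcuv hii
  refine ⟨⟨c, hc, hcuv⟩, fun hne => ?_⟩
  rcases hii hne with h1 | ⟨a, b, hab⟩
  · exact h1
  have hua : ∀ᵐ x ∂(volume.restrict Ω), u x = a := by
    rw [← hres]
    filter_upwards [ae_mono (Measure.restrict_mono inter_subset_left le_rfl) hab] with x hx
      using hx.1
  -- If `Ω` had positive measure, `u` would be a positive constant on `Ω` and zero outside, which
  -- `W^{1,p}` forbids.
  have hΩ0 : volume.restrict Ω = 0 := by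
    by_contra h0
    have : (ae (volume.restrict Ω)).NeBot := ae_neBot.2 h0
    obtain ⟨x, hx, hxa⟩ := (hu_pos.and hua).exists
    exact h0 (Measure.restrict_eq_zero.2 (hu.1.measure_eq_zero_of_indicator hN hp (hxa ▸ hx) hΩm
      ((ae_restrict_iff' hΩm).1 hua) (h.zero.mono fun _ hy hy' => (hy hy').1)))
  simp [hΩ0]
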